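/- Let $p\in(0,1)$, $q:=1-p$. Let $\mathsf{BS}(p)$ denote the standardized Bernoulli distribution, which assigns probability $p$ to the point $\sqrt{q/p}$ and probability $q$ to the point $-\sqrt{p/q}$. Let $\mathcal F_3$ be the class of all twice continuously differentiable functions $f\colon\mathbb R\to\mathbb R$ such that $f$ and $f''$ are nondecreasing and convex. Put $$m_*(p):=\frac{1+p+2p^2}{2\left(\sqrt{p-p^2}+2p^2\right)}\ \text{ if } 0<p\le\tfrac12,\qquad m_*(p):=1\ \text{ if } \tfrac12\le p<1.$$ Let $n\ge1$, let $X_1,\dots,X_n$ be independent random variables such that for every $i\in\{1,\dots,n\}$ one has $\mathsf E X_i\le0$ and $-a_i\le X_i\le b_i$ almost surely, where $a_i$ and $b_i$ are positive real numbers with $b_i/a_i\le q/p$, and let $\mathrm{BS}_1,\dots,\mathrm{BS}_n$ be independent random variables, each with the distribution $\mathsf{BS}(p)$. Then for every real $m\ge m_*(p)$ and every $f\in\mathcal F_3$ the two expectations below are finite and $$\mathsf E f(X_1+\dots+X_n)\le\mathsf E f\left(s^{(m)}\cdot(\mathrm{BS}_1+\dots+\mathrm{BS}_n)\right),\qquad\text{where}\quad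 s^{(m)}:=\left(\frac1n\sum_{i=1}^n(a_ib_i)^m\right)^{\frac1{2m}}.$$ Moreover, the lower bound $m_*(p)$ on $m$ is exact for each $p\in(0,1)$: for every real $m$ with $0<m<m_*(p)$ there are $n\ge1$, random variables $X_1,\dots,X_n$ and $\mathrm{BS}_1,\dots,\mathrm{BS}_n$ and numbers $a_1,\dots,a_n,b_1,\dots,b_n$ satisfying all the conditions above, and a function $f\in\mathcal F_3$, for which the inequality fails. -/

import Mathlib

open MeasureTheory ProbabilityTheory

noncomputable section

/-- The standardized Bernoulli distribution `BS(p)`, with `q = 1 - p`: mass `p` at `√(q / p)` and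
mass `q` at `-√(p / q)`. -/
def standardizedBernoulli (p : ℝ) : Measure ℝ :=
  ENNReal.ofReal p • Measure.dirac √((1 - p) / p) +
    ENNReal.ofReal (1 - p) • Measure.dirac (-√(p / (1 - p)))

/-- The class of all twice continuously differentiable functions `f : ℝ → ℝ` such that
`f` and `f''` are nondecreasing and convex. -/
def classF3 : Set (ℝ → ℝ) :=
  {f | ContDiff ℝ 2 f ∧ Monotone f ∧ ConvexOn ℝ Set.univ f ∧
    Monotone (iteratedDeriv 2 f) ∧ ConvexOn ℝ Set.univ (iteratedDeriv 2 f)}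

/-- The threshold `m_*(p)`, for `0 < p < 1`. -/
def mStar (p : ℝ) : ℝ :=
  if p ≤ 1 / 2 then (1 + p + 2 * p ^ 2) / (2 * (√(p - p ^ 2) + 2 * p ^ 2)) else 1

/-- The average `s^{(m)} = (n⁻¹ ∑ (a_i b_i)^m)^{1/(2m)}`. -/
def sMean {n : ℕ} (m : ℝ) (a b : Fin n → ℝ) : ℝ :=
  ((∑ i, (a i * b i) ^ m) / n) ^ (1 / (2 * m))

/-- `Y_1, …, Y_n` are i.i.d. random variables with the standardized Bernoulli distribution. -/
structure IsBernoulliSample {Ω : Type*} [MeasurableSpace Ω] (p : ℝ) {n : ℕ}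
    (Y : Fin n → Ω → ℝ) (μ : Measure Ω) : Prop where
  indep : iIndepFun Y μ
  law : ∀ i, HasLaw (Y i) (standardizedBernoulli p) μ

/-- `X_1, …, X_n` are independent random variables with nonpositive means, `-a_i ≤ X_i ≤ b_i`
almost surely, where `a_i, b_i > 0` and `b_i / a_i ≤ q / p` with `q = 1 - p`. -/
structure IsBoundedAsymmetric {Ω : Type*} [MeasurableSpace Ω] (p : ℝ) {n : ℕ}
    (a b : Fin n → ℝ) (X : Fin n → Ω → ℝ) (μ : Measure Ω) : Prop where
  measurable : ∀ i, Measurable (X i)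
  indep : iIndepFun X μ
  mean_nonpos : ∀ i, ∫ ω, X i ω ∂μ ≤ 0
  bounds : ∀ i, ∀ᵐ ω ∂μ, -a i ≤ X i ω ∧ X i ω ≤ b i
  a_pos : ∀ i, 0 < a i
  b_pos : ∀ i, 0 < b i
  asymmetry : ∀ i, b i / a i ≤ (1 - p) / p

end

/-! Write q = 1 - p, let Y have law BS(p), and set x_i = (a_i b_i)^m, so that √(a_i b_i) =
x_i^(1/(2m)).

One summand: since f is convex and nondecreasing, X_i may be replaced by the centred law on {-a_i,
b_i}. Since f'' is nondecreasing, E f grows with the asymmetry of a centred two-point law of fixed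
variance, and b_i / a_i ≤ q / p allows passing to √(a_i b_i) Y (`two_point_le_bernoulliOp`). By
independence this is iterated over the sum (`integral_sum_le_bernoulliOpProd`).

Two summands: moving two of the x_i closer together with fixed sum increases E f
(`bernoulliOp_rpow_le`). The sign of the derivative is `four_point_ineq` for g = f' with k = 2m - 1.
Comparing f'' with one of its chords reduces it to the functions (x - t)_+, that is, to the scalar
inequality `mul_two_mul_sub_le`. The worst t is a critical point, and k ≥ 2 m_* - 1 is what is
required there. Averaging pairs makes all x_i equal to their mean (`bernoulliOpProd_le_replicate`),
which is the right-hand side.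

Sharpness: take two summands with x = 1 ± e. The first-order term in e vanishes by symmetry, and the
second-order term is the limit s → 1 of the four-point inequality. For m < m_* a suitable truncated
cube gives it the wrong sign. -/

/-! ### The scalar inequality and the exponent threshold. -/

/-- The logarithmic form of the inequality between the power `s ^ k` and the extremal rational
function, along the curve of critical points. -/
theorem mul_log_le_log_of_critical {ρ v : ℝ} (hρ0 : 0 < ρ) (hρ1 : ρ < 1) (hv : ρ ≤ v)
    (hv1 : v < 1) :
    (1 + ρ ^ 2) / (ρ * (1 + ρ)) * (Real.log v + Real.log (1 - v) - Real.log (v - ρ ^ 2)) ≤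
      Real.log (ρ ^ 2) + Real.log (1 - v) + Real.log (1 + v) - Real.log (v - ρ ^ 2)
        - Real.log (v + ρ ^ 2) := by
  set k := (1 + ρ ^ 2) / (ρ * (1 + ρ)) with hk
  let D : ℝ → ℝ := fun v => Real.log (ρ ^ 2) + Real.log (1 - v) + Real.log (1 + v)
    - Real.log (v - ρ ^ 2) - Real.log (v + ρ ^ 2)
    - k * (Real.log v + Real.log (1 - v) - Real.log (v - ρ ^ 2))
  have hρ2 : ρ ^ 2 < ρ := by nlinarith
  have hD : ∀ x ∈ Set.Ico ρ 1, HasDerivAt D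
      (-1 / (1 - x) + 1 / (1 + x) - 1 / (x - ρ ^ 2) - 1 / (x + ρ ^ 2)
        - k * (1 / x + -1 / (1 - x) - 1 / (x - ρ ^ 2))) x := by
    intro x hx
    obtain ⟨hx1, hx2⟩ := hx
    have hx4 : 0 < id x + ρ ^ 2 := add_pos (hρ0.trans_le hx1) (by positivity)
    have e1 : HasDerivAt (fun v : ℝ => Real.log (1 - v)) (-1 / (1 - x)) x :=
      ((hasDerivAt_id x).const_sub 1).log (by simp only [id]; linarith)
    have e2 : HasDerivAt (fun v : ℝ => Real.log (1 + v)) (1 / (1 + x)) x :=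
      ((hasDerivAt_id x).const_add 1).log (by simp only [id]; linarith)
    have e3 : HasDerivAt (fun v : ℝ => Real.log (v - ρ ^ 2)) (1 / (x - ρ ^ 2)) x :=
      ((hasDerivAt_id x).sub_const _).log (by simp only [id]; linarith)
    have e4 : HasDerivAt (fun v : ℝ => Real.log (v + ρ ^ 2)) (1 / (x + ρ ^ 2)) x :=
      ((hasDerivAt_id x).add_const _).log hx4.ne'
    have e5 : HasDerivAt (fun v : ℝ => Real.log v) (1 / x) x :=
      (hasDerivAt_id x).log (by simp only [id]; linarith)
    have e0 := hasDerivAt_const x (Real.log (ρ ^ 2))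
    exact (((((e0.add e1).add e2).sub e3).sub e4).sub (((e5.add e1).sub e3).const_mul k)).congr_deriv
      (by ring)
  have hmono : MonotoneOn D (Set.Ico ρ 1) := by
    apply monotoneOn_of_hasDerivWithinAt_nonneg (convex_Ico ρ 1)
      (fun x hx => (hD x hx).continuousAt.continuousWithinAt)
      (fun x hx => (hD x (interior_subset hx)).hasDerivWithinAt)
    intro x hx
    obtain ⟨hx1, hx2⟩ := interior_subset hx
    have hx0 : 0 < x := by linarith
    have h1 : 0 < 1 - x := by linarith
    have h2 : 0 < x - ρ ^ 2 := by linarith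
    -- This is the numerator of the derivative of `D`. The value of `k` is the one for which it has
    -- a double root at `ρ`.
    have key : 2 * x ^ 2 * (ρ * (1 + ρ) * (1 - ρ ^ 2)) ≤
        (x ^ 2 - 2 * ρ ^ 2 * x + ρ ^ 2) * ((1 + x) * (x + ρ ^ 2)) := by
      have hy : 0 ≤ (x - ρ) ^ 2 := sq_nonneg _
      have : (x ^ 2 - 2 * ρ ^ 2 * x + ρ ^ 2) * ((1 + x) * (x + ρ ^ 2))
          - 2 * x ^ 2 * (ρ * (1 + ρ) * (1 - ρ ^ 2)) =
          (x - ρ) ^ 2 * ((x - ρ) ^ 2 + x * (4 * ρ - 2 * ρ ^ 2 + 1 + ρ ^ 2)) := by ring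
      have h3 : 0 ≤ (x - ρ) ^ 2 * ((x - ρ) ^ 2 + x * (4 * ρ - 2 * ρ ^ 2 + 1 + ρ ^ 2)) := by
        apply mul_nonneg hy
        apply add_nonneg hy
        apply mul_nonneg hx0.le
        nlinarith
      linarith
    have : -1 / (1 - x) + 1 / (1 + x) - 1 / (x - ρ ^ 2) - 1 / (x + ρ ^ 2)
        - k * (1 / x + -1 / (1 - x) - 1 / (x - ρ ^ 2)) =
        (1 + ρ ^ 2) * ((x ^ 2 - 2 * ρ ^ 2 * x + ρ ^ 2) * ((1 + x) * (x + ρ ^ 2))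
          - 2 * x ^ 2 * (ρ * (1 + ρ) * (1 - ρ ^ 2))) /
        (ρ * (1 + ρ) * (x * (1 - x) * (1 + x) * (x - ρ ^ 2) * (x + ρ ^ 2))) := by
      rw [hk]
      have : 1 + x ≠ 0 := by positivity
      have : 1 + ρ ≠ 0 := by positivity
      have : x + ρ ^ 2 ≠ 0 := by positivity
      have := h1.ne'
      have := h2.ne'
      field_simp
      ring
    rw [this]
    apply div_nonneg
    · exact mul_nonneg (by positivity) (by linarith)
    · positivity
  have h := hmono ⟨le_refl ρ, hρ1⟩ ⟨hv, hv1⟩ hv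
  have h0 : D ρ = 0 := by
    have a1 : Real.log (ρ ^ 2) = Real.log ρ + Real.log ρ := by
      rw [pow_two, Real.log_mul hρ0.ne' hρ0.ne']
    have a2 : Real.log (ρ - ρ ^ 2) = Real.log ρ + Real.log (1 - ρ) := by
      rw [← Real.log_mul hρ0.ne' (by linarith)]; ring_nf
    have a3 : Real.log (ρ + ρ ^ 2) = Real.log ρ + Real.log (1 + ρ) := by
      rw [← Real.log_mul hρ0.ne' (by linarith)]; ring_nf
    simp only [D, a1, a2, a3]
    ring
  rw [h0] at h
  simp only [D] at h
  linarith

/-- The sharp exponent for `p < 1 / 2`. -/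
theorem rpow_le_one_sub_of_critical {p w v : ℝ} (hp0 : 0 < p) (hp : p < 1 / 2)
    (hv : √(p / (1 - p)) ≤ v) (hv1 : v < 1)
    (hvw : (1 - p) * v ^ 2 = p * (1 - w) + (1 - p) * w * v) :
    (1 - w) ^ (1 / (p + √(p * (1 - p)))) ≤ 1 - w / (p + (1 - p) * v) := by
  have hq : 0 < 1 - p := by linarith
  set ρ := √(p / (1 - p)) with hρ
  have hρ0 : 0 < ρ := Real.sqrt_pos.2 (by positivity)
  have hρsq : ρ ^ 2 = p / (1 - p) := Real.sq_sqrt (by positivity)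
  have hpρ : p = (1 - p) * ρ ^ 2 := by rw [hρsq]; field_simp
  have hρ1 : ρ < 1 := by
    have : ρ ^ 2 < 1 := by rw [hρsq, div_lt_one hq]; linarith
    nlinarith
  have hq' : (1 - p) * (1 + ρ ^ 2) = 1 := by linarith
  have hsq : √(p * (1 - p)) = (1 - p) * ρ := by
    rw [Real.sqrt_eq_iff_eq_sq (by positivity) (by positivity), mul_pow, hρsq]
    field_simp
  have hk : 1 / (p + √(p * (1 - p))) = (1 + ρ ^ 2) / (ρ * (1 + ρ)) := by
    rw [hsq, div_eq_div_iff (by positivity) (by positivity)]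
    have : p + (1 - p) * ρ = (1 - p) * (ρ * (1 + ρ)) := by
      nlinarith
    rw [this]
    linear_combination (-ρ * (1 + ρ)) * hq'
  have hρ2 : ρ ^ 2 < ρ := by nlinarith
  have hvρ : 0 < v - ρ ^ 2 := by linarith
  have hv0 : 0 < v := by linarith
  have hvw' : v ^ 2 = ρ ^ 2 * (1 - w) + w * v := by
    have : (1 - p) * v ^ 2 = (1 - p) * (ρ ^ 2 * (1 - w) + w * v) := by
      linear_combination hvw + (1 - w) * hpρ
    exact mul_left_cancel₀ hq.ne' this
  -- The critical equation is linear in `w`, so the curve is parametrized rationally by `v`; `v = ρ`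
  -- corresponds to `w = 0`.
  have h1w : 1 - w = v * (1 - v) / (v - ρ ^ 2) := by
    rw [eq_div_iff hvρ.ne']; linear_combination hvw'
  have hw : w = (v ^ 2 - ρ ^ 2) / (v - ρ ^ 2) := by
    rw [eq_div_iff hvρ.ne']; linear_combination -hvw'
  have hR : 1 - w / (p + (1 - p) * v) =
      ρ ^ 2 * ((1 - v) * (1 + v)) / ((v - ρ ^ 2) * (v + ρ ^ 2)) := by
    have e : p + (1 - p) * v = (1 - p) * (v + ρ ^ 2) := by linear_combination hpρ
    have e2 : w / (p + (1 - p) * v) = (1 + ρ ^ 2) * (v ^ 2 - ρ ^ 2) /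
        ((v - ρ ^ 2) * (v + ρ ^ 2)) := by
      rw [e, hw, div_div, div_eq_div_iff (by positivity) (by positivity)]
      linear_combination (-(v ^ 2 - ρ ^ 2) * (v - ρ ^ 2) * (v + ρ ^ 2)) * hq'
    rw [e2]
    have := hvρ.ne'
    field_simp
    ring
  have h1v : 0 < 1 - v := by linarith
  rw [hk, hR, h1w, ← Real.log_le_log_iff (by positivity) (by positivity),
    Real.log_rpow (by positivity), Real.log_div (by positivity) (by positivity),
    Real.log_div (by positivity) (by positivity), Real.log_mul (by positivity) (by positivity),
    Real.log_mul (by positivity) (by positivity), Real.log_mul (by positivity) (by positivity),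
    Real.log_mul (by positivity) (by positivity)]
  have := mul_log_le_log_of_critical hρ0 hρ1 hv hv1
  linarith

/-- The exponents `k` admissible for `p`, that is, `k ≥ 2 m_*(p) - 1`. -/
theorem mStar_of_le {p : ℝ} (hp0 : 0 < p) (hp : p ≤ 1 / 2) :
    2 * mStar p - 1 = 1 / (p + √(p * (1 - p))) := by
  have e : p - p ^ 2 = p * (1 - p) := by ring
  rw [mStar, if_pos hp, e]
  have hr : √(p * (1 - p)) ^ 2 = p * (1 - p) := Real.sq_sqrt (by nlinarith)
  set r := √(p * (1 - p)) with hr'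
  have hr0 : 0 < r := Real.sqrt_pos.2 (by nlinarith)
  field_simp
  linear_combination -hr

theorem one_le_mStar {p : ℝ} (hp0 : 0 < p) (hp1 : p < 1) : 1 ≤ mStar p := by
  by_cases hp : p ≤ 1 / 2
  · have h := mStar_of_le hp0 hp
    have hr : √(p * (1 - p)) ≤ 1 / 2 := by
      rw [Real.sqrt_le_left (by norm_num)]; nlinarith [sq_nonneg (p - 1 / 2)]
    have : 1 ≤ 1 / (p + √(p * (1 - p))) := by
      rw [le_div_iff₀ (by positivity)]; linarith
    linarith
  · rw [mStar, if_neg hp]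

/-- The scalar inequality behind the two-variable comparison. -/
theorem mul_two_mul_sub_le {p k w v : ℝ} (hp0 : 0 < p) (hp1 : p < 1) (hk : 2 * mStar p - 1 ≤ k)
    (hw0 : 0 < w) (hw1 : w < 1) (hv : w ≤ v) :
    w * (2 * v - w) ≤
      (1 - (1 - w) ^ k) * (p + 2 * p * (v - w) + (1 - p) * v ^ 2) := by
  have hq : 0 < 1 - p := by linarith
  have hden : 0 ≤ p + 2 * p * (v - w) + (1 - p) * v ^ 2 := by
    have : 0 ≤ v - w := by linarith
    positivity
  -- `l` bounds the quotient of the left side by the quadratic in `v`, uniformly in `v`; the power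
  -- then only has to be compared with `l`.
  suffices h : ∃ l, l ≤ 1 - (1 - w) ^ k ∧ w * (2 * v - w) ≤
      l * (p + 2 * p * (v - w) + (1 - p) * v ^ 2) by
    obtain ⟨l, hl, h⟩ := h
    exact h.trans (mul_le_mul_of_nonneg_right hl hden)
  have hpow : ∀ k', k' ≤ k → (1 - w) ^ k ≤ (1 - w) ^ k' := fun k' h =>
    Real.rpow_le_rpow_of_exponent_ge (by linarith) (by linarith) h
  by_cases hp : p < 1 / 2
  · have hk' := hpow _ hk
    rw [mStar_of_le hp0 hp.le] at hk'
    set ρ := √(p / (1 - p)) with hρ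
    have hρ0 : 0 < ρ := Real.sqrt_pos.2 (by positivity)
    have hρsq : ρ ^ 2 = p / (1 - p) := Real.sq_sqrt (by positivity)
    have hpρ : p = (1 - p) * ρ ^ 2 := by rw [hρsq]; field_simp
    have hρ1 : ρ < 1 := by
      have : ρ ^ 2 < 1 := by rw [hρsq, div_lt_one hq]; linarith
      nlinarith
    have h1w : 0 < 1 - w := by linarith
    -- `d ^ 2` is the discriminant of the equation for the critical point `u` of that quotient; the
    -- two bounds on `d` say `ρ ≤ u < 1`.
    set d := √(w ^ 2 + 4 * ρ ^ 2 * (1 - w)) with hd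
    have hdsq : d ^ 2 = w ^ 2 + 4 * ρ ^ 2 * (1 - w) := Real.sq_sqrt (by positivity)
    have hd1 : 2 * ρ - w ≤ d := by
      apply Real.le_sqrt_of_sq_le
      nlinarith [mul_pos (mul_pos hρ0 hw0) (sub_pos.2 hρ1)]
    have hd2 : d < 2 - w := by
      rw [hd, Real.sqrt_lt' (by linarith)]
      nlinarith [mul_pos h1w (show 0 < 1 - ρ ^ 2 by nlinarith)]
    set u := (w + d) / 2 with hu
    have hu2 : u ^ 2 = ρ ^ 2 * (1 - w) + w * u := by
      rw [hu]; linear_combination hdsq / 4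
    have huw : (1 - p) * u ^ 2 = p * (1 - w) + (1 - p) * w * u := by
      linear_combination (1 - p) * hu2 - (1 - w) * hpρ
    have hu0 : 0 < u := by linarith
    have h := rpow_le_one_sub_of_critical hp0 hp (v := u) (by linarith) (by linarith) huw
    -- At a critical point the quotient equals the quotient of the derivatives, `2w / (2p + 2(1 -
    -- p)u)`. What remains is a multiple of `(v - u) ^ 2`.
    refine ⟨w / (p + (1 - p) * u), by linarith, ?_⟩
    have hpos : 0 < p + (1 - p) * u := by positivity
    rw [div_mul_eq_mul_div, le_div_iff₀ hpos, mul_assoc]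
    apply mul_le_mul_of_nonneg_left _ hw0.le
    nlinarith [mul_nonneg hq.le (sq_nonneg (v - u))]
  · have hk1 : 1 ≤ k := by linarith [one_le_mStar hp0 hp1]
    have h := hpow 1 hk1
    rw [Real.rpow_one] at h
    -- Here `l = w` suffices: after division by `w` the gap is `(1 - p)(v - 1)² + (2p - 1)(1 - w)`.
    refine ⟨w, by linarith, ?_⟩
    apply mul_le_mul_of_nonneg_left _ hw0.le
    nlinarith [mul_nonneg hq.le (sq_nonneg (v - 1)),
      mul_nonneg (show 0 ≤ 2 * p - 1 by linarith) (show 0 ≤ 1 - w by linarith)]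

/-! ### The four-point inequality. -/

theorem sub_le_sub_of_hasDerivAt_le {g h G l : ℝ → ℝ} {a b : ℝ} (hab : a ≤ b)
    (hg : ∀ x, HasDerivAt g (h x) x) (hG : ∀ x, HasDerivAt G (l x) x)
    (hle : ∀ x ∈ Set.Icc a b, h x ≤ l x) : g b - g a ≤ G b - G a := by
  have hd : ∀ x, HasDerivAt (fun x => G x - g x) (l x - h x) x := fun x => (hG x).sub (hg x)
  have hm : MonotoneOn (fun x => G x - g x) (Set.Icc a b) := by
    apply monotoneOn_of_hasDerivWithinAt_nonneg (convex_Icc a b)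
      (fun x _ => (hd x).continuousAt.continuousWithinAt)
      (fun x _ => (hd x).hasDerivWithinAt)
    intro x hx
    linarith [hle x (interior_subset hx)]
  have := hm (Set.left_mem_Icc.2 hab) (Set.right_mem_Icc.2 hab) hab
  linarith

theorem ConvexOn.mul_le_add_of_le_of_le {h : ℝ → ℝ} (hh : ConvexOn ℝ Set.univ h) {x y z : ℝ}
    (hxy : x ≤ y) (hyz : y ≤ z) : (z - x) * h y ≤ (z - y) * h x + (y - x) * h z := by
  rcases eq_or_lt_of_le (hxy.trans hyz) with hxz | hxz
  · have : y = x := le_antisymm (by linarith) hxy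
    subst this; subst hxz; simp
  have hd : 0 < z - x := by linarith
  have := hh.2 (Set.mem_univ x) (Set.mem_univ z)
    (div_nonneg (by linarith) hd.le : 0 ≤ (z - y) / (z - x))
    (div_nonneg (by linarith) hd.le : 0 ≤ (y - x) / (z - x))
    (by rw [← add_div, div_eq_one_iff_eq hd.ne']; ring)
  simp only [smul_eq_mul] at this
  have e : (z - y) / (z - x) * x + (y - x) / (z - x) * z = y := by
    field_simp; ring
  rw [e] at this
  have h2 := mul_le_mul_of_nonneg_left this hd.le
  calc (z - x) * h y ≤ _ := h2
    _ = _ := by field_simp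

/-- The four-point inequality, for a function whose derivative is nonnegative and convex. -/
theorem four_point_ineq {p k s : ℝ} (hp0 : 0 < p) (hp1 : p < 1) (hk : 2 * mStar p - 1 ≤ k)
    (hs0 : 0 < s) (hs1 : s < 1) {g h : ℝ → ℝ} (hg : ∀ x, HasDerivAt g (h x) x)
    (hh : ConvexOn ℝ Set.univ h) (hmono : Monotone h) (hnn : ∀ x, 0 ≤ h x) :
    s ^ k * (p * g (1 + s) + (1 - p) * g 1 - p * g s - (1 - p) * g 0) ≤
      p * g (1 + s) + (1 - p) * g s - p * g 1 - (1 - p) * g 0 := by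
  have hq : 0 < 1 - p := by linarith
  have hw : 0 < 1 - s := by linarith
  have hsk0 : 0 ≤ s ^ k := Real.rpow_nonneg hs0.le k
  have hsk : s ^ k ≤ s := by
    have := Real.rpow_le_rpow_of_exponent_ge hs0 hs1.le
      (show 1 ≤ k by linarith [one_le_mStar hp0 hp1])
    rwa [Real.rpow_one] at this
  have hH : ∀ v, 1 - s ≤ v → (1 - s) * (2 * v - (1 - s)) ≤
      (1 - s ^ k) * (p + 2 * p * (v - (1 - s)) + (1 - p) * v ^ 2) := by
    intro v hv
    have := mul_two_mul_sub_le hp0 hp1 hk hw (by linarith) hv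
    rwa [sub_sub_cancel] at this
  set S := s ^ k with hS
  have hS1 : 0 ≤ 1 - S := by linarith
  -- the chord of `h` on `[s, 1]`
  set κ := (h 1 - h s) / (1 - s) with hκ
  have hκ0 : 0 ≤ κ := div_nonneg (by linarith [hmono hs1.le]) hw.le
  set c := h 1 - κ with hc
  have hκs : κ * (1 - s) = h 1 - h s := by rw [hκ]; field_simp
  have hls : c + κ * s = h s := by rw [hc]; linarith
  have hin : ∀ x ∈ Set.Icc s 1, h x ≤ c + κ * x := by
    rintro x ⟨h1, h2⟩
    have := hh.mul_le_add_of_le_of_le h1 h2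
    have e : (1 - x) * h s + (x - s) * h 1 = (1 - s) * (c + κ * x) := by
      rw [hc]; linear_combination (1 - x) * hκs
    rw [e] at this
    exact le_of_mul_le_mul_left this hw
  have hleft : ∀ x, x ≤ s → c + κ * x ≤ h x := by
    intro x h1
    have := hh.mul_le_add_of_le_of_le h1 hs1.le
    have e : (1 - x) * h s = (1 - s) * (c + κ * x) + (s - x) * h 1 := by
      rw [hc]; linear_combination (1 - x) * hκs
    rw [e] at this
    exact le_of_mul_le_mul_left (by linarith) hw
  have hright : ∀ x, 1 ≤ x → c + κ * x ≤ h x := by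
    intro x h1
    have := hh.mul_le_add_of_le_of_le hs1.le h1
    have e : (x - s) * h 1 = (1 - s) * (c + κ * x) + (x - 1) * h s := by
      rw [hc]; linear_combination (1 - x) * hκs
    rw [e] at this
    exact le_of_mul_le_mul_left (by linarith) hw
  have hG : ∀ x, HasDerivAt (fun x : ℝ => c * x + κ * x ^ 2 / 2) (c + κ * x) x := by
    intro x
    exact (((hasDerivAt_id x).const_mul c).add
      (((hasDerivAt_pow 2 x).const_mul κ).div_const 2)).congr_deriv (by simp; ring)
  have a2 := sub_le_sub_of_hasDerivAt_le hs1.le hg hG hin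
  have a3 := sub_le_sub_of_hasDerivAt_le (a := 1) (b := 1 + s) (by linarith) hG hg
    (fun x hx => hright x hx.1)
  -- it remains to bound `g s - g 0` from below
  suffices hfin : ∃ A, A ≤ g s - g 0 ∧
      0 ≤ (1 - S) * (1 - p) * A - S * (c * 1 + κ * 1 ^ 2 / 2 - (c * s + κ * s ^ 2 / 2))
        + (1 - S) * p * (c * (1 + s) + κ * (1 + s) ^ 2 / 2 - (c * 1 + κ * 1 ^ 2 / 2)) by
    obtain ⟨A, hA, hfin⟩ := hfin
    have b1 := mul_le_mul_of_nonneg_left hA (mul_nonneg hS1 hq.le)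
    have b2 := mul_le_mul_of_nonneg_left a2 hsk0
    have b3 := mul_le_mul_of_nonneg_left a3 (mul_nonneg hS1 hp0.le)
    nlinarith
  -- With nonnegative intercept the chord can be used on all of `[0, s]`. Its constant part
  -- contributes `s - S ≥ 0`, its linear part the scalar inequality at `v = 1`.
  by_cases hc0 : 0 ≤ c
  · have a1 := sub_le_sub_of_hasDerivAt_le hs0.le hG hg (fun x hx => hleft x hx.2)
    refine ⟨_, a1, ?_⟩
    have h1 := hH 1 (by linarith)
    have h2 := mul_le_mul_of_nonneg_left h1 hκ0
    have h3 := mul_nonneg hc0 (show 0 ≤ s - S by linarith)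
    nlinarith
  · push Not at hc0
    have hκ1 : 0 < κ := by
      rcases hκ0.lt_or_eq with h' | h'
      · exact h'
      · rw [← h'] at hls; linarith [hnn s]
    -- The chord vanishes at `t`; on `[0, t]` the bound `0 ≤ h` is used instead. This leaves `κ (x -
    -- t)_+`, which is the scalar inequality at `v = 1 - t`.
    set t := -c / κ with ht
    have hct : c = -κ * t := by rw [ht]; field_simp
    have ht0 : 0 < t := div_pos (by linarith) hκ1
    have hts : t ≤ s := by
      rw [ht, div_le_iff₀ hκ1]; nlinarith [hnn s]
    have a0 : g 0 ≤ g t := (monotone_of_hasDerivAt_nonneg hg hnn) ht0.le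
    have a1 := sub_le_sub_of_hasDerivAt_le hts hG hg (fun x hx => hleft x hx.2)
    refine ⟨κ * (s - t) ^ 2 / 2, ?_, ?_⟩
    · rw [hct] at a1; nlinarith
    · have h1 := hH (1 - t) (by linarith)
      have h2 := mul_le_mul_of_nonneg_left h1 hκ0
      rw [hct]
      nlinarith

/-- The four values of `x Y₁ + y Y₂` with `y < x` have this form, with `s = y / x` and `L` equal to
`x` times the distance between the atoms of BS(p). -/
theorem four_point_ineq_affine {p k s : ℝ} (hp0 : 0 < p) (hp1 : p < 1)
    (hk : 2 * mStar p - 1 ≤ k) (hs0 : 0 < s) (hs1 : s < 1) {g h : ℝ → ℝ}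
    (hg : ∀ x, HasDerivAt g (h x) x) (hh : ConvexOn ℝ Set.univ h) (hmono : Monotone h)
    (hnn : ∀ x, 0 ≤ h x) {L : ℝ} (hL : 0 < L) (z : ℝ) :
    s ^ k * (p * g (z + L * (1 + s)) + (1 - p) * g (z + L) - p * g (z + L * s) - (1 - p) * g z) ≤
      p * g (z + L * (1 + s)) + (1 - p) * g (z + L * s) - p * g (z + L) - (1 - p) * g z := by
  have := four_point_ineq hp0 hp1 hk hs0 hs1 (g := fun x => g (z + L * x))
    (h := fun x => L * h (z + L * x)) (fun x => ?_) ?_ ?_ ?_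
  · simpa using this
  · have e : HasDerivAt (fun x => z + L * x) L x := by
      simpa using ((hasDerivAt_id x).const_mul L).const_add z
    exact ((hg _).comp x e).congr_deriv (by ring)
  · refine ⟨convex_univ, fun x _ y _ a b ha hb hab => ?_⟩
    have := hh.2 (Set.mem_univ (z + L * x)) (Set.mem_univ (z + L * y)) ha hb hab
    simp only [smul_eq_mul] at this ⊢
    have e : a * (z + L * x) + b * (z + L * y) = z + L * (a * x + b * y) := by
      linear_combination z * hab
    rw [e] at this
    nlinarith
  · intro x y hxy
    exact mul_le_mul_of_nonneg_left (hmono (by nlinarith)) hL.le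
  · intro x
    exact mul_nonneg hL.le (hnn _)

/-! ### Bernoulli operators and the comparison of two parameters. -/

/-- `f` belongs to the class `ℱ₃`, with first and second derivatives `f₁` and `f₂`. -/
structure IsF3 (f f₁ f₂ : ℝ → ℝ) : Prop where
  deriv : ∀ x, HasDerivAt f (f₁ x) x
  deriv₁ : ∀ x, HasDerivAt f₁ (f₂ x) x
  mono : Monotone f
  convex : ConvexOn ℝ Set.univ f
  mono₂ : Monotone f₂
  convex₂ : ConvexOn ℝ Set.univ f₂
  nonneg₂ : ∀ x, 0 ≤ f₂ x

/-- The operator `f ↦ (x ↦ E f (x + s Y))`, where `Y` has the distribution `BS(p)`. -/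
noncomputable def bernoulliOp (p s : ℝ) (f : ℝ → ℝ) (x : ℝ) : ℝ :=
  p * f (x + s * √((1 - p) / p)) + (1 - p) * f (x + s * -√(p / (1 - p)))

theorem bernoulliOp_comm (p s t : ℝ) (f : ℝ → ℝ) :
    bernoulliOp p s (bernoulliOp p t f) = bernoulliOp p t (bernoulliOp p s f) := by
  funext x
  simp only [bernoulliOp, add_right_comm x]
  ring

theorem HasDerivAt.bernoulliOp {f f₁ : ℝ → ℝ} (p s : ℝ) (hf : ∀ x, HasDerivAt f (f₁ x) x)
    (x : ℝ) : HasDerivAt (bernoulliOp p s f) (bernoulliOp p s f₁ x) x :=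
  (((hf _).comp_add_const x _).const_mul p).add (((hf _).comp_add_const x _).const_mul (1 - p))

theorem Monotone.bernoulliOp {f : ℝ → ℝ} {p : ℝ} (hp0 : 0 ≤ p) (hp1 : p ≤ 1) (s : ℝ)
    (hf : Monotone f) : Monotone (bernoulliOp p s f) := fun _ _ hxy =>
  add_le_add (mul_le_mul_of_nonneg_left (hf (by linarith)) hp0)
    (mul_le_mul_of_nonneg_left (hf (by linarith)) (sub_nonneg.2 hp1))

theorem ConvexOn.bernoulliOp {f : ℝ → ℝ} {p : ℝ} (hp0 : 0 ≤ p) (hp1 : p ≤ 1) (s : ℝ)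
    (hf : ConvexOn ℝ Set.univ f) : ConvexOn ℝ Set.univ (bernoulliOp p s f) := by
  have h : ∀ t, ConvexOn ℝ Set.univ fun x => f (x + t) := fun t => by
    simpa [Function.comp_def] using hf.translate_left t
  exact ((h _).smul hp0).add ((h _).smul (sub_nonneg.2 hp1))

theorem IsF3.bernoulliOp {f f₁ f₂ : ℝ → ℝ} {p : ℝ} (hp0 : 0 ≤ p) (hp1 : p ≤ 1) (s : ℝ)
    (hf : IsF3 f f₁ f₂) :
    IsF3 (bernoulliOp p s f) (bernoulliOp p s f₁) (bernoulliOp p s f₂) where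
  deriv := HasDerivAt.bernoulliOp p s hf.deriv
  deriv₁ := HasDerivAt.bernoulliOp p s hf.deriv₁
  mono := hf.mono.bernoulliOp hp0 hp1 s
  convex := hf.convex.bernoulliOp hp0 hp1 s
  mono₂ := hf.mono₂.bernoulliOp hp0 hp1 s
  convex₂ := hf.convex₂.bernoulliOp hp0 hp1 s
  nonneg₂ _ := add_nonneg (mul_nonneg hp0 (hf.nonneg₂ _))
    (mul_nonneg (sub_nonneg.2 hp1) (hf.nonneg₂ _))

theorem mul_sqrt_div_eq {p : ℝ} (hp0 : 0 < p) (hp1 : p < 1) :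
    p * √((1 - p) / p) = (1 - p) * √(p / (1 - p)) := by
  have hq : 0 < 1 - p := by linarith
  rw [← sq_eq_sq₀ (by positivity) (by positivity), mul_pow, mul_pow, Real.sq_sqrt (by positivity),
    Real.sq_sqrt (by positivity)]
  field_simp

theorem sqrt_div_mul_sqrt_div {p : ℝ} (hp0 : 0 < p) (hp1 : p < 1) :
    √(p / (1 - p)) * √((1 - p) / p) = 1 := by
  have hq : 0 < 1 - p := by linarith
  rw [← Real.sqrt_mul (by positivity), show p / (1 - p) * ((1 - p) / p) = 1 by field_simp,
    Real.sqrt_one]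

/-- The derivative of `E f (z + x Y₁ + y Y₂)` along a curve `(x, y)`. -/
theorem hasDerivAt_bernoulliOp_bernoulliOp {p : ℝ} (hp0 : 0 < p) (hp1 : p < 1) {f f₁ : ℝ → ℝ}
    (hf : ∀ x, HasDerivAt f (f₁ x) x) {x y : ℝ → ℝ} {x' y' e : ℝ} (hx : HasDerivAt x x' e)
    (hy : HasDerivAt y y' e) (z : ℝ) :
    HasDerivAt (fun e => bernoulliOp p (x e) (bernoulliOp p (y e) f) z)
      (p * √((1 - p) / p) *
        (x' * (p * f₁ (z + x e * √((1 - p) / p) + y e * √((1 - p) / p))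
          + (1 - p) * f₁ (z + x e * √((1 - p) / p) + y e * -√(p / (1 - p)))
          - p * f₁ (z + x e * -√(p / (1 - p)) + y e * √((1 - p) / p))
          - (1 - p) * f₁ (z + x e * -√(p / (1 - p)) + y e * -√(p / (1 - p))))
        + y' * (p * f₁ (z + x e * √((1 - p) / p) + y e * √((1 - p) / p))
          + (1 - p) * f₁ (z + x e * -√(p / (1 - p)) + y e * √((1 - p) / p))
          - p * f₁ (z + x e * √((1 - p) / p) + y e * -√(p / (1 - p)))
          - (1 - p) * f₁ (z + x e * -√(p / (1 - p)) + y e * -√(p / (1 - p)))))) e := by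
  have hr := mul_sqrt_div_eq hp0 hp1
  set β := √((1 - p) / p)
  set α := √(p / (1 - p))
  have hd : ∀ u v : ℝ, HasDerivAt (fun e => f (z + x e * u + y e * v))
      (f₁ (z + x e * u + y e * v) * (x' * u + y' * v)) e := fun u v =>
    (hf _).comp e (((hx.mul_const u).const_add z).add (hy.mul_const v))
  have := ((((hd β β).const_mul p).add ((hd β (-α)).const_mul (1 - p))).const_mul p).add
    ((((hd (-α) β).const_mul p).add ((hd (-α) (-α)).const_mul (1 - p))).const_mul (1 - p))
  refine this.congr_deriv ?_
  generalize f₁ (z + x e * β + y e * β) = A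
  generalize f₁ (z + x e * β + y e * -α) = C
  generalize f₁ (z + x e * -α + y e * β) = D
  generalize f₁ (z + x e * -α + y e * -α) = B
  linear_combination (x' * (p * D + (1 - p) * B) + y' * (p * C + (1 - p) * B)) * hr

/-- The parameters `h + e` and `h - e` have fixed sum, and the derivative in `e` is, up to a
positive factor, the difference of the two sides of the four-point inequality for the derivative of
`f`. -/
theorem bernoulliOp_rpow_antitone {p m : ℝ} (hp0 : 0 < p) (hp1 : p < 1) (hm : mStar p ≤ m)
    {f f₁ f₂ : ℝ → ℝ} (hf : IsF3 f f₁ f₂) {h : ℝ} (z : ℝ) :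
    AntitoneOn (fun e => bernoulliOp p ((h + e) ^ (1 / (2 * m)))
      (bernoulliOp p ((h - e) ^ (1 / (2 * m))) f) z) (Set.Ico 0 h) := by
  have hq : 0 < 1 - p := by linarith
  have hm1 : 1 ≤ m := (one_le_mStar hp0 hp1).trans hm
  set c := 1 / (2 * m) with hc
  have hc0 : 0 < c := by positivity
  have hck : c * (2 * m - 1) = 1 - c := by rw [hc]; field_simp
  have hx : ∀ e ∈ Set.Ico 0 h, HasDerivAt (fun e => (h + e) ^ c) (c * (h + e) ^ (c - 1)) e := by
    intro e he
    have h1 : HasDerivAt (fun e => h + e) 1 e := (hasDerivAt_id e).const_add h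
    exact (h1.rpow_const (Or.inl (by linarith [he.1, he.2]))).congr_deriv (by ring)
  have hy : ∀ e ∈ Set.Ico 0 h, HasDerivAt (fun e => (h - e) ^ c) (-(c * (h - e) ^ (c - 1))) e := by
    intro e he
    have h1 : HasDerivAt (fun e => h - e) (-1) e := (hasDerivAt_id e).const_sub h
    exact (h1.rpow_const (Or.inl (by linarith [he.1, he.2]))).congr_deriv (by ring)
  have hd := fun e he => hasDerivAt_bernoulliOp_bernoulliOp hp0 hp1 hf.deriv (hx e he) (hy e he) z
  apply antitoneOn_of_hasDerivWithinAt_nonpos (convex_Ico 0 h)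
    (fun e he => (hd e he).continuousAt.continuousWithinAt)
    (fun e he => (hd e (interior_subset he)).hasDerivWithinAt)
  intro e he
  rw [interior_Ico] at he
  obtain ⟨he0, heh⟩ := he
  have hβ : 0 < √((1 - p) / p) := Real.sqrt_pos.2 (by positivity)
  have hα : 0 < √(p / (1 - p)) := Real.sqrt_pos.2 (by positivity)
  set β := √((1 - p) / p)
  set α := √(p / (1 - p))
  have ha0 : 0 < h - e := by linarith
  have hb0 : 0 < h + e := by linarith
  set x := (h + e) ^ c with hxdef
  set y := (h - e) ^ c with hydef
  have hx0 : 0 < x := Real.rpow_pos_of_pos hb0 c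
  have hy0 : 0 < y := Real.rpow_pos_of_pos ha0 c
  have hyx : y < x := Real.rpow_lt_rpow ha0.le (by linarith) hc0
  have key := four_point_ineq_affine hp0 hp1 (k := 2 * m - 1) (by linarith) (s := y / x)
    (by positivity) ((div_lt_one hx0).2 hyx) hf.deriv₁ hf.convex₂ hf.mono₂ hf.nonneg₂
    (L := x * (α + β)) (by positivity) (z + x * -α + y * -α)
  have eA : z + x * -α + y * -α + x * (α + β) * (1 + y / x) = z + x * β + y * β := by
    field_simp; ring
  have eC : z + x * -α + y * -α + x * (α + β) = z + x * β + y * -α := by ring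
  have eD : z + x * -α + y * -α + x * (α + β) * (y / x) = z + x * -α + y * β := by
    field_simp; ring
  rw [eA, eC, eD] at key
  -- The exponent `2m - 1` arises here: this power is the ratio of the speeds at which `x` grows and
  -- `y` decreases.
  have hs : (y / x) ^ (2 * m - 1) = (h - e) ^ (1 - c) * (h + e) ^ (c - 1) := by
    rw [Real.div_rpow hy0.le hx0.le, hxdef, hydef, ← Real.rpow_mul ha0.le, ← Real.rpow_mul hb0.le,
      hck, div_eq_mul_inv, ← Real.rpow_neg hb0.le, neg_sub]
  rw [hs] at key
  have hpos := Real.rpow_nonneg ha0.le (c - 1)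
  have h2 := mul_le_mul_of_nonneg_left key hpos
  have h3 : (h - e) ^ (c - 1) * (h - e) ^ (1 - c) = 1 := by
    rw [← Real.rpow_add ha0]; simp
  rw [← mul_assoc, ← mul_assoc, h3, one_mul] at h2
  apply mul_nonpos_of_nonneg_of_nonpos (by positivity)
  nlinarith [mul_le_mul_of_nonneg_left h2 hc0.le]

/-- Moving two of the parameters closer together increases the expectation. -/
theorem bernoulliOp_rpow_le {p m : ℝ} (hp0 : 0 < p) (hp1 : p < 1) (hm : mStar p ≤ m)
    {f f₁ f₂ : ℝ → ℝ} (hf : IsF3 f f₁ f₂) {a b u : ℝ} (ha : 0 < a) (hau : a ≤ u) (hub : u ≤ b)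
    (z : ℝ) :
    bernoulliOp p (a ^ (1 / (2 * m))) (bernoulliOp p (b ^ (1 / (2 * m))) f) z ≤
      bernoulliOp p (u ^ (1 / (2 * m))) (bernoulliOp p ((a + b - u) ^ (1 / (2 * m))) f) z := by
  wlog hu : (a + b) / 2 ≤ u generalizing u
  · have := this (u := a + b - u) (by linarith) (by linarith) (by linarith)
    rwa [sub_sub_cancel, bernoulliOp_comm p ((a + b - u) ^ (1 / (2 * m)))] at this
  have := bernoulliOp_rpow_antitone hp0 hp1 hm hf (h := (a + b) / 2) z
    (a := u - (a + b) / 2) (b := (b - a) / 2) ⟨by linarith, by linarith⟩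
    ⟨by linarith, by linarith⟩ (by linarith)
  simp only at this
  rw [show (a + b) / 2 + (b - a) / 2 = b by ring, show (a + b) / 2 - (b - a) / 2 = a by ring,
    show (a + b) / 2 + (u - (a + b) / 2) = u by ring,
    show (a + b) / 2 - (u - (a + b) / 2) = a + b - u by ring, bernoulliOp_comm p (b ^ _)] at this
  exact this

/-! ### Averaging all the parameters. -/

instance (p c : ℝ) : LeftCommutative fun (x : ℝ) (g : ℝ → ℝ) => bernoulliOp p (x ^ c) g :=
  ⟨fun _ _ _ => bernoulliOp_comm _ _ _ _⟩

/-- The composition of the operators `bernoulliOp p (x ^ c)` over a multiset of numbers `x`. -/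
noncomputable def bernoulliOpProd (p c : ℝ) (M : Multiset ℝ) (f : ℝ → ℝ) : ℝ → ℝ :=
  M.foldr (fun x g => bernoulliOp p (x ^ c) g) f

theorem bernoulliOpProd_cons (p c x : ℝ) (M : Multiset ℝ) (f : ℝ → ℝ) :
    bernoulliOpProd p c (x ::ₘ M) f = bernoulliOp p (x ^ c) (bernoulliOpProd p c M f) :=
  Multiset.foldr_cons _ _ _ _

theorem bernoulliOpProd_bernoulliOp (p c s : ℝ) (M : Multiset ℝ) (f : ℝ → ℝ) :
    bernoulliOpProd p c M (bernoulliOp p s f) = bernoulliOp p s (bernoulliOpProd p c M f) := by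
  induction M using Multiset.induction_on with
  | empty => rfl
  | cons x M ih => rw [bernoulliOpProd_cons, bernoulliOpProd_cons, ih, bernoulliOp_comm]

theorem IsF3.bernoulliOpProd {p : ℝ} (hp0 : 0 ≤ p) (hp1 : p ≤ 1) (c : ℝ) (M : Multiset ℝ)
    {f f₁ f₂ : ℝ → ℝ} (hf : IsF3 f f₁ f₂) :
    IsF3 (bernoulliOpProd p c M f) (bernoulliOpProd p c M f₁) (bernoulliOpProd p c M f₂) := by
  induction M using Multiset.induction_on with
  | empty => exact hf
  | cons x M ih =>
    simp only [bernoulliOpProd_cons]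
    exact ih.bernoulliOp hp0 hp1 _

theorem Multiset.exists_lt_and_exists_gt_of_sum_eq {M : Multiset ℝ} {u : ℝ}
    (hsum : M.sum = M.card * u) (hne : ∃ x ∈ M, x ≠ u) : (∃ a ∈ M, a < u) ∧ ∃ b ∈ M, u < b := by
  obtain ⟨x, hxM, hxu⟩ := hne
  have hs : (M.map fun _ => u).sum = (M.map id).sum := by simp [hsum]
  constructor
  · by_contra! hcon
    have := Multiset.sum_lt_sum (s := M) (f := fun _ => u) (g := id) hcon
      ⟨x, hxM, lt_of_le_of_ne (hcon x hxM) hxu.symm⟩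
    exact this.ne hs
  · by_contra! hcon
    have := Multiset.sum_lt_sum (s := M) (f := id) (g := fun _ => u) hcon
      ⟨x, hxM, lt_of_le_of_ne (hcon x hxM) hxu⟩
    exact this.ne hs.symm

/-- Replacing all the parameters by their mean increases the expectation. -/
theorem bernoulliOpProd_le_replicate {p m : ℝ} (hp0 : 0 < p) (hp1 : p < 1) (hm : mStar p ≤ m)
    {u : ℝ} (n : ℕ) {M : Multiset ℝ} (hcard : M.card = n) (hpos : ∀ x ∈ M, 0 < x)
    (hsum : M.sum = n * u) {f f₁ f₂ : ℝ → ℝ} (hf : IsF3 f f₁ f₂) (z : ℝ) :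
    bernoulliOpProd p (1 / (2 * m)) M f z ≤
      bernoulliOpProd p (1 / (2 * m)) (Multiset.replicate n u) f z := by
  induction n generalizing M f f₁ f₂ with
  | zero => rw [Multiset.card_eq_zero.1 hcard]; simp
  | succ n ih =>
    by_cases hne : ∃ x ∈ M, x ≠ u
    · obtain ⟨⟨a, haM, hau⟩, b, hbM, hub⟩ :=
        Multiset.exists_lt_and_exists_gt_of_sum_eq (by rw [hsum, hcard]) hne
      obtain ⟨N, rfl⟩ := Multiset.exists_cons_of_mem haM
      have hbN : b ∈ N := (Multiset.mem_cons.1 hbM).resolve_left (by linarith)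
      obtain ⟨N, rfl⟩ := Multiset.exists_cons_of_mem hbN
      have ha := hpos a haM
      have h1 := bernoulliOp_rpow_le hp0 hp1 hm
        (hf.bernoulliOpProd hp0.le hp1.le (1 / (2 * m)) N) ha hau.le hub.le z
      -- The new parameter `u` has its final value and is absorbed into the function, leaving one
      -- parameter fewer with the same mean; hence the induction over varying `f`.
      have h2 := ih (M := (a + b - u) ::ₘ N) (by simpa using hcard) ?_ ?_
        (hf.bernoulliOp hp0.le hp1.le (u ^ (1 / (2 * m))))
      · rw [bernoulliOpProd_cons, bernoulliOpProd_cons]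
        rw [bernoulliOpProd_bernoulliOp, bernoulliOpProd_bernoulliOp, bernoulliOpProd_cons] at h2
        rw [Multiset.replicate_succ, bernoulliOpProd_cons]
        exact h1.trans h2
      · intro x hx
        rcases Multiset.mem_cons.1 hx with rfl | hx
        · linarith
        · exact hpos x (by simp [hx])
      · simp only [Multiset.sum_cons] at hsum ⊢
        push_cast at hsum
        linarith
    · push Not at hne
      rw [Multiset.eq_replicate.2 ⟨hcard, hne⟩]

/-! ### Comparison of a single summand. -/

theorem IsF3.continuous₂ {f f₁ f₂ : ℝ → ℝ} (hf : IsF3 f f₁ f₂) : Continuous f₂ :=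
  continuousOn_univ.1 (hf.convex₂.continuousOn isOpen_univ)

theorem IsF3.continuous {f f₁ f₂ : ℝ → ℝ} (hf : IsF3 f f₁ f₂) : Continuous f :=
  continuous_iff_continuousAt.2 fun x => (hf.deriv x).continuousAt

/-- Second-order Taylor expansion with integral remainder. -/
theorem IsF3.taylor {f f₁ f₂ : ℝ → ℝ} (hf : IsF3 f f₁ f₂) (x u : ℝ) :
    f (x + u) = f x + f₁ x * u + u ^ 2 * ∫ t in (0 : ℝ)..1, (1 - t) * f₂ (x + t * u) := by
  have hc := hf.continuous₂
  have hd : ∀ t ∈ Set.uIcc (0 : ℝ) 1,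
      HasDerivAt (fun t => f (x + t * u) + (1 - t) * u * f₁ (x + t * u))
      (u ^ 2 * ((1 - t) * f₂ (x + t * u))) t := by
    intro t _
    have e : HasDerivAt (fun t => x + t * u) u t := by
      simpa using ((hasDerivAt_id t).mul_const u).const_add x
    have e2 : HasDerivAt (fun t => (1 - t) * u) (-u) t := by
      simpa using ((hasDerivAt_id t).const_sub 1).mul_const u
    exact (((hf.deriv _).comp t e).add (e2.mul ((hf.deriv₁ _).comp t e))).congr_deriv (by
      simp only [Function.comp_apply]; ring)
  have := intervalIntegral.integral_eq_sub_of_hasDerivAt hd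
    (Continuous.intervalIntegrable (by fun_prop) _ _)
  rw [intervalIntegral.integral_const_mul] at this
  rw [this]
  simp
  ring

theorem IsF3.monotone_remainder {f f₁ f₂ : ℝ → ℝ} (hf : IsF3 f f₁ f₂) (x : ℝ) :
    Monotone fun u : ℝ => ∫ t in (0 : ℝ)..1, (1 - t) * f₂ (x + t * u) := by
  intro u v huv
  have hc := hf.continuous₂
  apply intervalIntegral.integral_mono_on zero_le_one
    (Continuous.intervalIntegrable (by fun_prop) _ _)
    (Continuous.intervalIntegrable (by fun_prop) _ _)
  intro t ht
  exact mul_le_mul_of_nonneg_left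
    (hf.mono₂ (by linarith [mul_le_mul_of_nonneg_left huv ht.1])) (by linarith [ht.2])

/-- Among the centred two-point distributions with the same variance, the more asymmetric one has
the larger expectation. -/
theorem two_point_le_bernoulliOp {p : ℝ} (hp0 : 0 < p) (hp1 : p < 1) {f f₁ f₂ : ℝ → ℝ}
    (hf : IsF3 f f₁ f₂) {a b : ℝ} (ha : 0 < a) (hb : 0 < b) (hab : b / a ≤ (1 - p) / p) (z : ℝ) :
    b * f (z - a) + a * f (z + b) ≤ (a + b) * bernoulliOp p √(a * b) f z := by
  have hq : 0 < 1 - p := by linarith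
  have hr := mul_sqrt_div_eq hp0 hp1
  have hβ : 0 < √((1 - p) / p) := Real.sqrt_pos.2 (by positivity)
  have hα : 0 < √(p / (1 - p)) := Real.sqrt_pos.2 (by positivity)
  have hβ2 : √((1 - p) / p) ^ 2 = (1 - p) / p := Real.sq_sqrt (by positivity)
  have hαβ := sqrt_div_mul_sqrt_div hp0 hp1
  have hσ : 0 < √(a * b) := Real.sqrt_pos.2 (by positivity)
  have hσ2 : √(a * b) ^ 2 = a * b := Real.sq_sqrt (by positivity)
  unfold bernoulliOp
  set β := √((1 - p) / p)
  set α := √(p / (1 - p))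
  set σ := √(a * b)
  set b' := σ * β with hb'
  set a' := σ * α with ha'
  have hb0 : 0 < b' := by positivity
  have ha0 : 0 < a' := by positivity
  have hprod : a' * b' = a * b := by
    rw [ha', hb', ← hσ2]; linear_combination σ ^ 2 * hαβ
  have hbb : b ≤ b' := by
    rw [← abs_of_pos hb, ← abs_of_pos hb0, ← sq_le_sq, hb', mul_pow, hσ2, hβ2]
    rw [div_le_iff₀ ha] at hab
    nlinarith
  have hpd : p * (a' + b') = a' := by rw [ha', hb']; linear_combination σ * hr
  rw [show z + σ * -α = z - a' by rw [ha']; ring]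
  -- The expansion is at the lower atom `z - a'` of the target law, so its remainder is carried by
  -- the upper atom alone, at `u = a' + b'`. There the monotone `J` is at its largest, and both laws
  -- have the same first two moments.
  set J : ℝ → ℝ := fun u => ∫ t in (0 : ℝ)..1, (1 - t) * f₂ (z - a' + t * u) with hJ
  have hJm : Monotone J := hf.monotone_remainder (z - a')
  have ht : ∀ u, f (z - a' + u) = f (z - a') + f₁ (z - a') * u + u ^ 2 * J u :=
    hf.taylor (z - a')
  have t1 := ht (a' - a)
  have t2 := ht (a' + b)
  have t3 := ht (a' + b')
  rw [show z - a' + (a' - a) = z - a by ring] at t1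
  rw [show z - a' + (a' + b) = z + b by ring] at t2
  rw [show z - a' + (a' + b') = z + b' by ring] at t3
  rw [t1, t2, t3]
  have j1 := mul_le_mul_of_nonneg_left (hJm (show a' - a ≤ a' + b' by linarith))
    (mul_nonneg hb.le (sq_nonneg (a' - a)))
  have j2 := mul_le_mul_of_nonneg_left (hJm (show a' + b ≤ a' + b' by linarith))
    (mul_nonneg ha.le (sq_nonneg (a' + b)))
  have e : b * (a' - a) ^ 2 + a * (a' + b) ^ 2 = (a + b) * (p * (a' + b') ^ 2) := by
    linear_combination (-(a + b)) * hprod - (a + b) * (a' + b') * hpd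
  generalize f (z - a') = F0
  generalize f₁ (z - a') = F1
  have e2 := congrArg (· * J (a' + b')) e
  have e3 := congrArg (· * (F1 * (a + b))) hpd
  nlinarith

theorem integrable_comp_of_ae_abs_le {Ω : Type*} [MeasurableSpace Ω] {μ : Measure Ω}
    [IsFiniteMeasure μ] {U : Ω → ℝ} (hU : AEMeasurable U μ) {C : ℝ} (hC : ∀ᵐ ω ∂μ, |U ω| ≤ C)
    {f : ℝ → ℝ} (hf : Continuous f) : Integrable (fun ω => f (U ω)) μ := by
  obtain ⟨K, hK⟩ := (isCompact_Icc (a := -C) (b := C)).exists_bound_of_continuousOn hf.continuousOn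
  refine Integrable.of_bound (hf.measurable.comp_aemeasurable hU).aestronglyMeasurable K ?_
  filter_upwards [hC] with ω hω
  exact hK _ (abs_le.1 hω)

/-- The expectation of `f (z + X)` for a bounded `X` with nonpositive mean. -/
theorem integral_le_bernoulliOp {Ω : Type*} [MeasurableSpace Ω] {μ : Measure Ω}
    [IsProbabilityMeasure μ] {p : ℝ} (hp0 : 0 < p) (hp1 : p < 1) {f f₁ f₂ : ℝ → ℝ}
    (hf : IsF3 f f₁ f₂) {a b : ℝ} (ha : 0 < a) (hb : 0 < b) (hab : b / a ≤ (1 - p) / p)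
    {X : Ω → ℝ} (hX : Measurable X) (hmean : ∫ ω, X ω ∂μ ≤ 0)
    (hbd : ∀ᵐ ω ∂μ, -a ≤ X ω ∧ X ω ≤ b) (z : ℝ) :
    ∫ ω, f (z + X ω) ∂μ ≤ bernoulliOp p √(a * b) f z := by
  have habs : ∀ᵐ ω ∂μ, |X ω| ≤ a + b := by
    filter_upwards [hbd] with ω hω
    exact abs_le.2 ⟨by linarith [hω.1], by linarith [hω.2]⟩
  have hi := integrable_comp_of_ae_abs_le hX.aemeasurable habs (f := fun x => f (z + x))
    (hf.continuous.comp (by fun_prop))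
  have hiX := integrable_comp_of_ae_abs_le hX.aemeasurable habs (f := fun x => x) continuous_id
  have hs : 0 < a + b := by positivity
  -- `f` is bounded by its chord over `[z - a, z + b]`; the chord has nonnegative slope, so a
  -- nonpositive mean can be replaced by zero.
  have h1 : ∫ ω, (a + b) * f (z + X ω) ∂μ ≤
      ∫ ω, (b * f (z - a) + a * f (z + b)) + (f (z + b) - f (z - a)) * X ω ∂μ := by
    apply integral_mono_ae (hi.const_mul _) ((integrable_const _).add (hiX.const_mul _))
    filter_upwards [hbd] with ω hω
    have := hf.convex.mul_le_add_of_le_of_le (x := z - a) (y := z + X ω) (z := z + b)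
      (by linarith [hω.1]) (by linarith [hω.2])
    simp only [Pi.add_apply]
    nlinarith
  rw [integral_const_mul, integral_add (integrable_const _) (hiX.const_mul _), integral_const_mul,
    integral_const] at h1
  simp only [probReal_univ, one_smul] at h1
  have h2 := two_point_le_bernoulliOp hp0 hp1 hf ha hb hab z
  have h3 : 0 ≤ f (z + b) - f (z - a) := sub_nonneg.2 (hf.mono (by linarith))
  have h4 := mul_nonpos_of_nonneg_of_nonpos h3 hmean
  exact le_of_mul_le_mul_left (by linarith) hs

/-! ### Sums of independent variables. -/

theorem IndepFun.integral_add_le {Ω : Type*} [MeasurableSpace Ω] {μ : Measure Ω}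
    [IsProbabilityMeasure μ] {U V : Ω → ℝ} (hU : AEMeasurable U μ) (hV : AEMeasurable V μ)
    (hUV : IndepFun U V μ) {C D : ℝ} (hC : ∀ᵐ ω ∂μ, |U ω| ≤ C) (hD : ∀ᵐ ω ∂μ, |V ω| ≤ D)
    {f g : ℝ → ℝ} (hf : Continuous f) (hg : Continuous g)
    (hfg : ∀ y, ∫ ω, f (y + V ω) ∂μ ≤ g y) : ∫ ω, f (U ω + V ω) ∂μ ≤ ∫ ω, g (U ω) ∂μ := by
  have hi : Integrable (fun ω => f (U ω + V ω)) μ := by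
    refine integrable_comp_of_ae_abs_le (hU.add hV) (C := C + D) ?_ hf
    filter_upwards [hC, hD] with ω h1 h2
    exact (abs_add_le _ _).trans (add_le_add h1 h2)
  have hF : Continuous fun q : ℝ × ℝ => f (q.1 + q.2) := by fun_prop
  have hmap := hUV.map_prod_eq_prod_map_map hU hV
  have hpm : AEMeasurable (fun ω => (U ω, V ω)) μ := hU.prodMk hV
  have : IsProbabilityMeasure (μ.map U) := Measure.isProbabilityMeasure_map hU
  have : IsProbabilityMeasure (μ.map V) := Measure.isProbabilityMeasure_map hV
  have hiF : Integrable (fun q : ℝ × ℝ => f (q.1 + q.2)) ((μ.map U).prod (μ.map V)) := by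
    rw [← hmap, integrable_map_measure hF.aestronglyMeasurable hpm]
    exact hi
  calc ∫ ω, f (U ω + V ω) ∂μ = ∫ q, f (q.1 + q.2) ∂((μ.map U).prod (μ.map V)) := by
        rw [← hmap, integral_map hpm hF.aestronglyMeasurable]
    _ = ∫ y, ∫ v, f (y + v) ∂(μ.map V) ∂(μ.map U) := integral_prod _ hiF
    _ ≤ ∫ y, g y ∂(μ.map U) := by
        apply integral_mono hiF.integral_prod_left
        · rw [integrable_map_measure hg.aestronglyMeasurable hU]
          exact integrable_comp_of_ae_abs_le hU hC hg
        · intro y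
          simp only
          rw [integral_map hV (by fun_prop : Continuous fun v => f (y + v)).aestronglyMeasurable]
          exact hfg y
    _ = ∫ ω, g (U ω) ∂μ := integral_map hU hg.aestronglyMeasurable

theorem continuous_bernoulliOp {p s : ℝ} {f : ℝ → ℝ} (hf : Continuous f) :
    Continuous (bernoulliOp p s f) := by
  unfold bernoulliOp
  fun_prop

theorem ae_abs_sum_le {Ω ι : Type*} [MeasurableSpace Ω] {μ : Measure Ω} {X : ι → Ω → ℝ}
    {C : ι → ℝ} (hC : ∀ i, ∀ᵐ ω ∂μ, |X i ω| ≤ C i) (S : Finset ι) :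
    ∀ᵐ ω ∂μ, |∑ i ∈ S, X i ω| ≤ ∑ i ∈ S, C i := by
  have : ∀ᵐ ω ∂μ, ∀ i ∈ S, |X i ω| ≤ C i := (Finset.eventually_all S).2 fun i _ => hC i
  filter_upwards [this] with ω h
  exact (Finset.abs_sum_le_sum_abs _ _).trans (Finset.sum_le_sum h)

/-- Expectations of functions of sums of independent variables are bounded by the composition of the
bounding operators. -/
theorem integral_sum_le_bernoulliOpProd {Ω ι : Type*} [MeasurableSpace Ω] {μ : Measure Ω}
    [IsProbabilityMeasure μ] {X : ι → Ω → ℝ} (hX : ∀ i, AEMeasurable (X i) μ)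
    (hind : iIndepFun X μ) {C : ι → ℝ} (hC : ∀ i, ∀ᵐ ω ∂μ, |X i ω| ≤ C i)
    {p c : ℝ} {x : ι → ℝ} (F : Set (ℝ → ℝ)) (hcont : ∀ f ∈ F, Continuous f)
    (hop : ∀ f ∈ F, ∀ s, bernoulliOp p s f ∈ F)
    (hle : ∀ f ∈ F, ∀ i z, ∫ ω, f (z + X i ω) ∂μ ≤ bernoulliOp p (x i ^ c) f z)
    (S : Finset ι) {f : ℝ → ℝ} (hf : f ∈ F) (z : ℝ) :
    ∫ ω, f (z + ∑ i ∈ S, X i ω) ∂μ ≤ bernoulliOpProd p c (S.val.map x) f z := by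
  classical
  induction S using Finset.induction_on generalizing f with
  | empty => simp [bernoulliOpProd]
  | insert j S hj ih =>
    have hI := (hind.indepFun_finsetSum_of_notMem₀ hX hj)
    have hS : AEMeasurable (fun ω => ∑ i ∈ S, X i ω) μ :=
      Finset.aemeasurable_fun_sum S fun i _ => hX i
    have e : (∑ i ∈ S, X i) = fun ω => ∑ i ∈ S, X i ω := by ext; simp
    rw [e] at hI
    have h := IndepFun.integral_add_le hS (hX j) hI (ae_abs_sum_le hC S) (hC j)
      (f := fun y => f (z + y)) (g := fun y => bernoulliOp p (x j ^ c) f (z + y))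
      ((hcont f hf).comp (by fun_prop)) ((hcont _ (hop f hf _)).comp (by fun_prop))
      (fun y => by simpa only [add_assoc] using hle f hf j (z + y))
    rw [Finset.insert_val_of_notMem hj, Multiset.map_cons, bernoulliOpProd_cons,
      ← bernoulliOpProd_bernoulliOp]
    simp only [Finset.sum_insert hj, add_comm (X j _)]
    exact h.trans (ih (hop f hf _))

/-! ### The class, the law BS(p), and the upper bound. -/

theorem exists_isF3_of_mem_classF3 {f : ℝ → ℝ} (hf : f ∈ classF3) : ∃ f₁ f₂, IsF3 f f₁ f₂ := by
  obtain ⟨hc, hm, hcv, hm2, hcv2⟩ := hf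
  have hc' : ContDiff ℝ (1 + 1) f := by simpa [one_add_one_eq_two] using hc
  have h1 := contDiff_succ_iff_deriv.1 hc'
  have hd : Differentiable ℝ f := h1.1
  have hd1 : Differentiable ℝ (deriv f) := h1.2.2.differentiable one_ne_zero
  have e : iteratedDeriv 2 f = deriv (deriv f) := by
    rw [iteratedDeriv_succ, iteratedDeriv_one]
  rw [e] at hm2 hcv2
  refine ⟨deriv f, deriv (deriv f), fun x => (hd x).hasDerivAt, fun x => (hd1 x).hasDerivAt,
    hm, hcv, hm2, hcv2, fun x => Monotone.deriv_nonneg ?_⟩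
  exact monotoneOn_univ.1 (hcv.monotoneOn_deriv fun x _ => hd x)

theorem mem_classF3_of_isF3 {f f₁ f₂ : ℝ → ℝ} (hf : IsF3 f f₁ f₂) : f ∈ classF3 := by
  have e1 : deriv f = f₁ := funext fun x => (hf.deriv x).deriv
  have e2 : deriv f₁ = f₂ := funext fun x => (hf.deriv₁ x).deriv
  have e : iteratedDeriv 2 f = f₂ := by
    rw [iteratedDeriv_succ, iteratedDeriv_one, e1, e2]
  refine ⟨?_, hf.mono, hf.convex, e ▸ hf.mono₂, e ▸ hf.convex₂⟩
  have h1 : ContDiff ℝ 1 f₁ := contDiff_one_iff_deriv.2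
    ⟨fun x => (hf.deriv₁ x).differentiableAt, e2 ▸ hf.continuous₂⟩
  rw [← one_add_one_eq_two, contDiff_succ_iff_deriv]
  exact ⟨fun x => (hf.deriv x).differentiableAt, by simp, e1 ▸ h1⟩

theorem isProbabilityMeasure_standardizedBernoulli {p : ℝ} (hp0 : 0 ≤ p) (hp1 : p ≤ 1) :
    IsProbabilityMeasure (standardizedBernoulli p) := by
  constructor
  simp only [standardizedBernoulli, Measure.coe_add, Measure.coe_smul, Pi.add_apply,
    Pi.smul_apply, measure_univ, smul_eq_mul, mul_one]
  rw [← ENNReal.ofReal_add hp0 (by linarith)]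
  simp

theorem integral_standardizedBernoulli {p : ℝ} (hp0 : 0 ≤ p) (hp1 : p ≤ 1) (f : ℝ → ℝ) :
    ∫ y, f y ∂standardizedBernoulli p =
      p * f √((1 - p) / p) + (1 - p) * f (-√(p / (1 - p))) := by
  have hi : ∀ r x : ℝ, Integrable f (ENNReal.ofReal r • Measure.dirac x) := fun r x =>
    (integrable_dirac (by simp)).smul_measure ENNReal.ofReal_ne_top
  rw [standardizedBernoulli, integral_add_measure (hi _ _) (hi _ _), integral_smul_measure,
    integral_smul_measure, integral_dirac, integral_dirac, ENNReal.toReal_ofReal hp0,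
    ENNReal.toReal_ofReal (by linarith), smul_eq_mul, smul_eq_mul]

theorem ae_standardizedBernoulli (p : ℝ) :
    ∀ᵐ y ∂standardizedBernoulli p, y = √((1 - p) / p) ∨ y = -√(p / (1 - p)) := by
  rw [standardizedBernoulli, ae_add_measure_iff]
  constructor
  · exact Measure.ae_smul_measure (by simp [ae_dirac_eq]) _
  · exact Measure.ae_smul_measure (by simp [ae_dirac_eq]) _

theorem ae_of_hasLaw_standardizedBernoulli {Ω : Type*} [MeasurableSpace Ω] {μ : Measure Ω} {p : ℝ}
    {Y : Ω → ℝ} (hY : HasLaw Y (standardizedBernoulli p) μ) :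
    ∀ᵐ ω ∂μ, Y ω = √((1 - p) / p) ∨ Y ω = -√(p / (1 - p)) := by
  have := ae_standardizedBernoulli p
  rw [← hY.map_eq] at this
  exact ae_of_ae_map hY.aemeasurable this

theorem ae_abs_mul_le_of_hasLaw {Ω : Type*} [MeasurableSpace Ω] {μ : Measure Ω} {p : ℝ}
    {Y : Ω → ℝ} (hY : HasLaw Y (standardizedBernoulli p) μ) (s : ℝ) :
    ∀ᵐ ω ∂μ, |s * Y ω| ≤ |s| * (√((1 - p) / p) + √(p / (1 - p))) := by
  filter_upwards [ae_of_hasLaw_standardizedBernoulli hY] with ω h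
  rw [abs_mul]
  apply mul_le_mul_of_nonneg_left _ (abs_nonneg s)
  have h1 := Real.sqrt_nonneg ((1 - p) / p)
  have h2 := Real.sqrt_nonneg (p / (1 - p))
  rcases h with h | h <;> rw [h]
  · rw [abs_of_nonneg h1]; linarith
  · rw [abs_neg, abs_of_nonneg h2]; linarith

theorem integral_comp_of_hasLaw {Ω : Type*} [MeasurableSpace Ω] {μ : Measure Ω} {p : ℝ}
    (hp0 : 0 ≤ p) (hp1 : p ≤ 1) {Y : Ω → ℝ} (hY : HasLaw Y (standardizedBernoulli p) μ)
    {f : ℝ → ℝ} (hf : Continuous f) (s z : ℝ) :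
    ∫ ω, f (z + s * Y ω) ∂μ = bernoulliOp p s f z := by
  have hc : Continuous fun y => f (z + s * y) := by fun_prop
  have := hY.integral_comp hc.aestronglyMeasurable
  rw [integral_standardizedBernoulli hp0 hp1] at this
  exact this

theorem bernoulliOpProd_neg (p c : ℝ) (M : Multiset ℝ) (f : ℝ → ℝ) (z : ℝ) :
    bernoulliOpProd p c M (fun x => -f x) z = -bernoulliOpProd p c M f z := by
  induction M using Multiset.induction_on generalizing z with
  | empty => rfl
  | cons x M ih =>
    simp only [bernoulliOpProd_cons, bernoulliOp, ih]
    ring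

/-- For continuous functions the one-variable bound is an equality, and this class is closed under
negation, so the bound for sums applied to `f` and `-f` gives both inequalities. -/
theorem IsBernoulliSample.integral_eq {Ω : Type*} [MeasurableSpace Ω] {μ : Measure Ω}
    [IsProbabilityMeasure μ] {p : ℝ} (hp0 : 0 ≤ p) (hp1 : p ≤ 1) {n : ℕ} {Y : Fin n → Ω → ℝ}
    (hY : IsBernoulliSample p Y μ) {f : ℝ → ℝ} (hf : Continuous f) (c : ℝ) (x : Fin n → ℝ) :
    ∫ ω, f (∑ i, x i ^ c * Y i ω) ∂μ = bernoulliOpProd p c (Finset.univ.val.map x) f 0 := by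
  have hm : ∀ i, AEMeasurable (fun ω => x i ^ c * Y i ω) μ := fun i =>
    (hY.law i).aemeasurable.const_mul _
  have hind : iIndepFun (fun i ω => x i ^ c * Y i ω) μ :=
    hY.indep.comp (fun i y => x i ^ c * y) (fun i => by fun_prop)
  have hle : ∀ g : ℝ → ℝ, Continuous g →
      ∫ ω, g (∑ i, x i ^ c * Y i ω) ∂μ ≤ bernoulliOpProd p c (Finset.univ.val.map x) g 0 := by
    intro g hg
    have := integral_sum_le_bernoulliOpProd hm hind
      (fun i => ae_abs_mul_le_of_hasLaw (hY.law i) (x i ^ c)) (p := p) (c := c) (x := x)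
      {g | Continuous g} (fun _ h => h) (fun _ h _ => continuous_bernoulliOp h)
      (fun g hg i z => (integral_comp_of_hasLaw hp0 hp1 (hY.law i) hg _ z).le) Finset.univ hg 0
    simpa only [zero_add] using this
  apply le_antisymm (hle f hf)
  have := hle (fun x => -f x) hf.neg
  rw [integral_neg, bernoulliOpProd_neg] at this
  linarith

theorem IsBoundedAsymmetric.ae_abs_le {Ω : Type*} [MeasurableSpace Ω] {μ : Measure Ω} {p : ℝ}
    {n : ℕ} {a b : Fin n → ℝ} {X : Fin n → Ω → ℝ} (hX : IsBoundedAsymmetric p a b X μ)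
    (i : Fin n) : ∀ᵐ ω ∂μ, |X i ω| ≤ a i + b i := by
  filter_upwards [hX.bounds i] with ω hω
  exact abs_le.2 ⟨by linarith [hω.1, hX.b_pos i], by linarith [hω.2, hX.a_pos i]⟩

theorem IsBoundedAsymmetric.integral_le {Ω Ω' : Type*} [MeasurableSpace Ω] {μ : Measure Ω}
    [IsProbabilityMeasure μ] [MeasurableSpace Ω'] {ν : Measure Ω'} [IsProbabilityMeasure ν]
    {p : ℝ} (hp0 : 0 < p) (hp1 : p < 1) {n : ℕ} (hn : 0 < n) {a b : Fin n → ℝ} {X : Fin n → Ω → ℝ}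
    (hX : IsBoundedAsymmetric p a b X μ) {Y : Fin n → Ω' → ℝ} (hY : IsBernoulliSample p Y ν)
    {m : ℝ} (hm : mStar p ≤ m) {f f₁ f₂ : ℝ → ℝ} (hf : IsF3 f f₁ f₂) :
    ∫ ω, f (∑ i, X i ω) ∂μ ≤ ∫ ω, f (sMean m a b * ∑ i, Y i ω) ∂ν := by
  have hm0 : 0 < m := by linarith [one_le_mStar hp0 hp1]
  set c := 1 / (2 * m) with hc
  set x : Fin n → ℝ := fun i => (a i * b i) ^ m with hx
  have hab : ∀ i, 0 < a i * b i := fun i => mul_pos (hX.a_pos i) (hX.b_pos i)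
  have hxc : ∀ i, x i ^ c = √(a i * b i) := by
    intro i
    rw [hx, ← Real.rpow_mul (hab i).le, Real.sqrt_eq_rpow, hc]
    congr 1
    field_simp
  set u := (∑ i, x i) / n with hu
  have h1 := integral_sum_le_bernoulliOpProd (fun i => (hX.measurable i).aemeasurable) hX.indep
    hX.ae_abs_le (p := p) (c := c) (x := x) {g | ∃ g₁ g₂, IsF3 g g₁ g₂}
    (fun g ⟨_, _, h⟩ => h.continuous)
    (fun g ⟨_, _, h⟩ s => ⟨_, _, h.bernoulliOp hp0.le hp1.le s⟩)
    (fun g ⟨_, _, h⟩ i z => by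
      rw [hxc]
      exact integral_le_bernoulliOp hp0 hp1 h (hX.a_pos i) (hX.b_pos i) (hX.asymmetry i)
        (hX.measurable i) (hX.mean_nonpos i) (hX.bounds i) z) Finset.univ ⟨f₁, f₂, hf⟩ 0
  have h2 := bernoulliOpProd_le_replicate hp0 hp1 hm (u := u) n (M := Finset.univ.val.map x)
    (by simp) (by
      intro y hy
      obtain ⟨i, -, rfl⟩ := Multiset.mem_map.1 hy
      exact Real.rpow_pos_of_pos (hab i) m) (by
      change ∑ i, x i = n * u
      rw [hu]; field_simp) hf 0
  have h3 := hY.integral_eq hp0.le hp1.le hf.continuous c (fun _ => u)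
  have e : (Finset.univ : Finset (Fin n)).val.map (fun _ => u) = Multiset.replicate n u := by simp
  rw [e] at h3
  simp only [zero_add] at h1
  simp only [← Finset.mul_sum] at h3
  have e2 : sMean m a b = u ^ c := rfl
  rw [e2, h3]
  exact h1.trans h2

theorem integrable_comp_sum {Ω : Type*} [MeasurableSpace Ω] {μ : Measure Ω}
    [IsProbabilityMeasure μ] {n : ℕ} {X : Fin n → Ω → ℝ} (hX : ∀ i, AEMeasurable (X i) μ)
    {C : Fin n → ℝ} (hC : ∀ i, ∀ᵐ ω ∂μ, |X i ω| ≤ C i) {f : ℝ → ℝ} (hf : Continuous f) :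
    Integrable (fun ω => f (∑ i, X i ω)) μ :=
  integrable_comp_of_ae_abs_le (Finset.aemeasurable_fun_sum _ fun i _ => hX i)
    (ae_abs_sum_le hC Finset.univ) hf

/-! ### Sharpness of the threshold. -/

theorem hasDerivAt_max_zero_pow (n : ℕ) (x : ℝ) :
    HasDerivAt (fun x : ℝ => max x 0 ^ (n + 2)) ((n + 2) * max x 0 ^ (n + 1)) x := by
  rcases lt_trichotomy x 0 with hx | hx | hx
  · rw [max_eq_right hx.le]
    have : HasDerivAt (fun _ : ℝ => (0 : ℝ)) ((n + 2) * 0 ^ (n + 1)) x := by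
      simpa using hasDerivAt_const x (0 : ℝ)
    refine this.congr_of_eventuallyEq ?_
    filter_upwards [Iio_mem_nhds hx] with y hy
    rw [max_eq_right (le_of_lt hy)]; simp
  · subst hx
    have h1 : HasDerivWithinAt (fun x : ℝ => max x 0 ^ (n + 2)) 0 (Set.Iic 0) 0 :=
      (hasDerivWithinAt_const (0 : ℝ) _ (0 : ℝ)).congr
        (fun y hy => by rw [max_eq_right hy]; simp) (by simp)
    have h2 : HasDerivWithinAt (fun x : ℝ => max x 0 ^ (n + 2)) 0 (Set.Ici 0) 0 := by
      have := (hasDerivAt_pow (n + 2) (0 : ℝ)).hasDerivWithinAt (s := Set.Ici 0)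
      simp only [Nat.add_one_sub_one, ne_eq, Nat.add_eq_zero_iff, one_ne_zero, and_false,
        not_false_eq_true, zero_pow, mul_zero] at this
      exact this.congr (fun y hy => by rw [max_eq_left hy]) (by simp)
    have := h1.union h2
    rw [Set.Iic_union_Ici, hasDerivWithinAt_univ] at this
    simpa using this
  · rw [max_eq_left hx.le]
    have := hasDerivAt_pow (n + 2) x
    push_cast at this
    refine (this.congr_of_eventuallyEq ?_)
    filter_upwards [Ioi_mem_nhds hx] with y hy
    rw [max_eq_left (le_of_lt hy)]

theorem isF3_max_sub_pow (t : ℝ) :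
    IsF3 (fun x => max (x - t) 0 ^ 3) (fun x => 3 * max (x - t) 0 ^ 2)
      (fun x => 6 * max (x - t) 0) := by
  have hd : ∀ x, HasDerivAt (fun x => max (x - t) 0 ^ 3) (3 * max (x - t) 0 ^ 2) x := fun x =>
    ((hasDerivAt_max_zero_pow 1 (x - t)).comp_sub_const x t).congr_deriv (by norm_num)
  have hd1 : ∀ x, HasDerivAt (fun x => 3 * max (x - t) 0 ^ 2) (6 * max (x - t) 0) x := fun x =>
    (((hasDerivAt_max_zero_pow 0 (x - t)).comp_sub_const x t).const_mul 3).congr_deriv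
      (by norm_num; ring)
  have hm2 : Monotone fun x : ℝ => 6 * max (x - t) 0 := fun x y hxy => by
    dsimp only
    gcongr
  have hnn : ∀ x : ℝ, 0 ≤ 6 * max (x - t) 0 := fun x => by positivity
  have hm1 : Monotone fun x : ℝ => 3 * max (x - t) 0 ^ 2 := monotone_of_hasDerivAt_nonneg hd1 hnn
  have hm : Monotone fun x : ℝ => max (x - t) 0 ^ 3 :=
    monotone_of_hasDerivAt_nonneg hd fun x => by simp only [Pi.zero_apply]; positivity
  refine ⟨hd, hd1, hm, ?_, hm2, ?_, hnn⟩
  · have e : deriv (fun x : ℝ => max (x - t) 0 ^ 3) = fun x => 3 * max (x - t) 0 ^ 2 :=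
      funext fun x => (hd x).deriv
    exact Monotone.convexOn_univ_of_deriv (fun x => (hd x).differentiableAt) (e ▸ hm1)
  · have h1 : ConvexOn ℝ Set.univ fun x : ℝ => x - t :=
      (convexOn_id convex_univ).sub (concaveOn_const t convex_univ)
    exact (h1.sup (convexOn_const 0 convex_univ)).smul (by norm_num)

/-- A second-order criterion for the failure of the two-variable comparison near equal
parameters. -/
theorem exists_bernoulliOp_lt {p c : ℝ} (hp0 : 0 < p) (hp1 : p < 1) (hc : 0 < c)
    {f f₁ f₂ : ℝ → ℝ} (hf : IsF3 f f₁ f₂)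
    (hlt : (1 - c) * (p * f₁ (√((1 - p) / p) + √((1 - p) / p))
        + (1 - p) * f₁ (√((1 - p) / p) - √(p / (1 - p)))
        - p * f₁ (√((1 - p) / p) - √(p / (1 - p)))
        - (1 - p) * f₁ (-√(p / (1 - p)) - √(p / (1 - p)))) <
      c * (√(p / (1 - p)) + √((1 - p) / p)) * f₂ (√((1 - p) / p) - √(p / (1 - p)))) :
    ∃ e, 0 < e ∧ e < 1 ∧ bernoulliOp p (1 ^ c) (bernoulliOp p (1 ^ c) f) 0 <
      bernoulliOp p ((1 + e) ^ c) (bernoulliOp p ((1 - e) ^ c) f) 0 := by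
  have hq : 0 < 1 - p := by linarith
  have hx : ∀ e ∈ Set.Ioo (-1 : ℝ) 1, ∀ c : ℝ,
      HasDerivAt (fun e => (1 + e) ^ c) (c * (1 + e) ^ (c - 1)) e := by
    intro e he c
    have h1 : HasDerivAt (fun e : ℝ => 1 + e) 1 e := (hasDerivAt_id e).const_add 1
    exact (h1.rpow_const (Or.inl (by linarith [he.1, he.2]))).congr_deriv (by ring)
  have hy : ∀ e ∈ Set.Ioo (-1 : ℝ) 1, ∀ c : ℝ,
      HasDerivAt (fun e => (1 - e) ^ c) (-(c * (1 - e) ^ (c - 1))) e := by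
    intro e he c
    have h1 : HasDerivAt (fun e : ℝ => 1 - e) (-1) e := (hasDerivAt_id e).const_sub 1
    exact (h1.rpow_const (Or.inl (by linarith [he.1, he.2]))).congr_deriv (by ring)
  have hd := fun e he => hasDerivAt_bernoulliOp_bernoulliOp hp0 hp1 hf.deriv (hx e he c)
    (hy e he c) 0
  have hβ : 0 < √((1 - p) / p) := Real.sqrt_pos.2 (by positivity)
  set β := √((1 - p) / p)
  set α := √(p / (1 - p))
  have h0 : (0 : ℝ) ∈ Set.Ioo (-1 : ℝ) 1 := ⟨by norm_num, by norm_num⟩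
  have hg : ∀ u v : ℝ, HasDerivAt (fun e : ℝ => f₁ (0 + (1 + e) ^ c * u + (1 - e) ^ c * v))
      (f₂ (u + v) * (c * u - c * v)) 0 := by
    intro u v
    have := (hf.deriv₁ (0 + (1 + 0) ^ c * u + (1 - 0) ^ c * v)).comp (0 : ℝ)
      ((((hx 0 h0 c).mul_const u).const_add 0).add ((hy 0 h0 c).mul_const v))
    exact this.congr_deriv (by simp; ring_nf; simp)
  have hx1 := (hx 0 h0 (c - 1)).const_mul c
  have hy1 := ((hy 0 h0 (c - 1)).const_mul c).neg
  -- `W` is the derivative of the expectation in `e`, divided by the positive constant `p * β`. It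
  -- vanishes at `0` by symmetry, so its slope there decides, and `hlt` makes that slope positive.
  let W : ℝ → ℝ := fun e =>
    c * (1 + e) ^ (c - 1) * (p * f₁ (0 + (1 + e) ^ c * β + (1 - e) ^ c * β)
          + (1 - p) * f₁ (0 + (1 + e) ^ c * β + (1 - e) ^ c * -α)
          - p * f₁ (0 + (1 + e) ^ c * -α + (1 - e) ^ c * β)
          - (1 - p) * f₁ (0 + (1 + e) ^ c * -α + (1 - e) ^ c * -α))
        + -(c * (1 - e) ^ (c - 1)) * (p * f₁ (0 + (1 + e) ^ c * β + (1 - e) ^ c * β)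
          + (1 - p) * f₁ (0 + (1 + e) ^ c * -α + (1 - e) ^ c * β)
          - p * f₁ (0 + (1 + e) ^ c * β + (1 - e) ^ c * -α)
          - (1 - p) * f₁ (0 + (1 + e) ^ c * -α + (1 - e) ^ c * -α))
  have hW0 : W 0 = 0 := by
    simp only [W, add_zero, sub_zero, Real.one_rpow, mul_one, one_mul, zero_add, add_comm (-α) β]
    ring
  have hWd : HasDerivAt W (2 * c * (c * (α + β) * f₂ (β - α)
      - (1 - c) * (p * f₁ (β + β) + (1 - p) * f₁ (β - α) - p * f₁ (β - α)
        - (1 - p) * f₁ (-α - α)))) 0 := by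
    have := (hx1.mul (((((hg β β).const_mul p).add ((hg β (-α)).const_mul (1 - p))).sub
      ((hg (-α) β).const_mul p)).sub ((hg (-α) (-α)).const_mul (1 - p)))).add
      (hy1.mul (((((hg β β).const_mul p).add ((hg (-α) β).const_mul (1 - p))).sub
      ((hg β (-α)).const_mul p)).sub ((hg (-α) (-α)).const_mul (1 - p))))
    refine this.congr_deriv ?_
    simp only [add_zero, sub_zero, Real.one_rpow, mul_one, one_mul, zero_add, add_comm (-α) β,
      Pi.add_apply, Pi.sub_apply, Pi.neg_apply, ← sub_eq_add_neg]
    ring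
  have hpos : deriv W 0 > 0 := by
    rw [hWd.deriv]
    exact mul_pos (by positivity) (by linarith)
  have hev := eventually_nhdsWithin_sign_eq_of_deriv_pos hpos hW0
  obtain ⟨d, hd0, hdW⟩ := Metric.eventually_nhds_iff.1 hev
  set e := min d 1 / 2 with he
  have hm0 : 0 < min d 1 := lt_min hd0 one_pos
  have he0 : 0 < e := by positivity
  have hed : e < d := by have := min_le_left d 1; linarith
  have he1 : e < 1 := by have := min_le_right d 1; linarith
  have hsub : ∀ x ∈ Set.Icc 0 e, x ∈ Set.Ioo (-1 : ℝ) 1 := fun x hx =>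
    ⟨by linarith [hx.1], by linarith [hx.2]⟩
  have hmono := strictMonoOn_of_hasDerivWithinAt_pos (convex_Icc 0 e)
    (fun x hx => (hd x (hsub x hx)).continuousAt.continuousWithinAt)
    (fun x hx => (hd x (hsub x (interior_subset hx))).hasDerivWithinAt) (by
      intro x hx
      rw [interior_Icc] at hx
      have h1 := hdW (y := x) (by
        rw [Real.dist_eq, sub_zero, abs_of_pos hx.1]; linarith [hx.2])
      rw [sub_zero, sign_pos hx.1, sign_eq_one_iff] at h1
      exact mul_pos (mul_pos hp0 hβ) h1)
  have := hmono (Set.left_mem_Icc.2 he0.le) (Set.right_mem_Icc.2 he0.le) he0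
  simp only [add_zero, sub_zero] at this
  exact ⟨e, he0, he1, this⟩

/-- Below the threshold `mStar p`, a truncated cube satisfies the criterion of
`exists_bernoulliOp_lt`. -/
theorem exists_isF3_of_lt_mStar {p m : ℝ} (hp0 : 0 < p) (hp1 : p < 1) (hm0 : 0 < m)
    (hm : m < mStar p) : ∃ f f₁ f₂, IsF3 f f₁ f₂ ∧
      (1 - 1 / (2 * m)) * (p * f₁ (√((1 - p) / p) + √((1 - p) / p))
        + (1 - p) * f₁ (√((1 - p) / p) - √(p / (1 - p)))
        - p * f₁ (√((1 - p) / p) - √(p / (1 - p)))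
        - (1 - p) * f₁ (-√(p / (1 - p)) - √(p / (1 - p)))) <
      1 / (2 * m) * (√(p / (1 - p)) + √((1 - p) / p)) *
        f₂ (√((1 - p) / p) - √(p / (1 - p))) := by
  have hq : 0 < 1 - p := by linarith
  have hβ : 0 < √((1 - p) / p) := Real.sqrt_pos.2 (by positivity)
  have hα : 0 < √(p / (1 - p)) := Real.sqrt_pos.2 (by positivity)
  have hα2 : √(p / (1 - p)) ^ 2 = p / (1 - p) := Real.sq_sqrt (by positivity)
  have hsq : √(p * (1 - p)) = (1 - p) * √(p / (1 - p)) := by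
    rw [Real.sqrt_eq_iff_eq_sq (by nlinarith) (by positivity), mul_pow, hα2]
    field_simp
  have hk : p ≤ 1 / 2 → 2 * m - 1 < 1 / (p + (1 - p) * √(p / (1 - p))) := fun h => by
    rw [← hsq, ← mStar_of_le hp0 h]; linarith
  set β := √((1 - p) / p)
  set α := √(p / (1 - p))
  have hpα : (1 - p) * α ^ 2 = p := by rw [hα2]; field_simp
  set c := 1 / (2 * m) with hc
  have hc0 : 0 < c := by positivity
  have hcm : c * (2 * m) = 1 := by rw [hc]; field_simp
  set L := α + β with hL
  have hL0 : 0 < L := by positivity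
  by_cases hp : p ≤ 1 / 2
  · have hα1 : α ≤ 1 := by
      have : α ^ 2 ≤ 1 := by rw [hα2, div_le_one hq]; linarith
      nlinarith
    -- The kink lies `α * L` below the middle value `β - α`. In units of `L` this is `v = α = √(p /
    -- (1 - p))`, the limit of the critical point as `w → 0`.
    refine ⟨_, _, _, isF3_max_sub_pow (β - α - α * L), ?_⟩
    have e1 : max (β + β - (β - α - α * L)) 0 = (1 + α) * L := by
      rw [max_eq_left (by nlinarith [mul_pos hα hL0])]; rw [hL]; ring
    have e2 : max (β - α - (β - α - α * L)) 0 = α * L := by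
      rw [max_eq_left (by nlinarith [mul_pos hα hL0])]; ring
    have e3 : max (-α - α - (β - α - α * L)) 0 = 0 := by
      rw [max_eq_right]
      have : -α - α - (β - α - α * L) = (α - 1) * L := by rw [hL]; ring
      rw [this]
      exact mul_nonpos_of_nonpos_of_nonneg (by linarith) hL0.le
    rw [e1, e2, e3]
    have h1 := hk hp
    have h2 : (1 - c) * (p * (1 + α)) < c * α := by
      rw [lt_div_iff₀ (by positivity)] at h1
      have h3 := mul_lt_mul_of_pos_left h1 (mul_pos hc0 hα)
      have e : c * α * ((2 * m - 1) * (p + (1 - p) * α)) = (1 - c) * (p * (1 + α)) := by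
        linear_combination (α * (p + (1 - p) * α)) * hcm + (1 - c) * hpα
      rw [e, mul_one] at h3
      exact h3
    have h4 := mul_lt_mul_of_pos_left h2 (show 0 < 6 * L ^ 2 by positivity)
    have e : p * (3 * ((1 + α) * L) ^ 2) + (1 - p) * (3 * (α * L) ^ 2) - p * (3 * (α * L) ^ 2)
        - (1 - p) * (3 * 0 ^ 2) = 6 * L ^ 2 * (p * (1 + α)) := by
      linear_combination 3 * L ^ 2 * hpα
    rw [e]
    linarith
  · rw [mStar, if_neg hp] at hm
    have hc2 : 1 < 2 * c := by nlinarith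
    have hd : 0 < 2 * c - 1 := by linarith
    -- The kink is put at distance `y` below the lowest value. The terms linear in `y` compare `2(1
    -- - c)` with `2c`, so `c > 1 / 2` wins once `y` is large.
    set y := |(1 - c) * (1 + 2 * p) * L| / (2 * (2 * c - 1)) with hy
    have hy0 : 0 ≤ y := by positivity
    have hy2 : (1 - c) * (1 + 2 * p) * L ≤ 2 * (2 * c - 1) * y := by
      have : 2 * (2 * c - 1) * y = |(1 - c) * (1 + 2 * p) * L| := by rw [hy]; field_simp
      rw [this]
      exact le_abs_self _
    refine ⟨_, _, _, isF3_max_sub_pow (-α - α - y), ?_⟩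
    have e1 : max (β + β - (-α - α - y)) 0 = 2 * L + y := by
      rw [max_eq_left (by linarith)]; rw [hL]; ring
    have e2 : max (β - α - (-α - α - y)) 0 = L + y := by
      rw [max_eq_left (by linarith)]; rw [hL]; ring
    have e3 : max (-α - α - (-α - α - y)) 0 = y := by
      rw [max_eq_left (by linarith)]; ring
    rw [e1, e2, e3]
    have e : p * (3 * (2 * L + y) ^ 2) + (1 - p) * (3 * (L + y) ^ 2) - p * (3 * (L + y) ^ 2)
        - (1 - p) * (3 * y ^ 2) = 3 * L * ((1 + 2 * p) * L + 2 * y) := by ring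
    rw [e]
    have h1 : (1 - c) * ((1 + 2 * p) * L + 2 * y) < 2 * c * (L + y) := by
      nlinarith [mul_pos hc0 hL0]
    have h2 := mul_lt_mul_of_pos_left h1 (show 0 < 3 * L by positivity)
    linarith

/-- Scaled Bernoulli variables are extremal: their mean is zero, `b i / a i` equals `(1 - p) / p`,
and `a i * b i = s i ^ 2`. -/
theorem isBoundedAsymmetric_mul {Ω : Type*} [MeasurableSpace Ω] {μ : Measure Ω} {p : ℝ}
    (hp0 : 0 < p) (hp1 : p < 1) {n : ℕ} {Y : Fin n → Ω → ℝ} (hY : IsBernoulliSample p Y μ)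
    (hmeas : ∀ i, Measurable (Y i)) {s : Fin n → ℝ} (hs : ∀ i, 0 < s i) :
    IsBoundedAsymmetric p (fun i => s i * √(p / (1 - p))) (fun i => s i * √((1 - p) / p))
      (fun i ω => s i * Y i ω) μ := by
  have hq : 0 < 1 - p := by linarith
  have hβ : 0 < √((1 - p) / p) := Real.sqrt_pos.2 (by positivity)
  have hα : 0 < √(p / (1 - p)) := Real.sqrt_pos.2 (by positivity)
  have hr := mul_sqrt_div_eq hp0 hp1
  refine ⟨fun i => (hmeas i).const_mul _,
    hY.indep.comp (fun i y => s i * y) (fun i => by fun_prop), fun i => ?_, fun i => ?_,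
    fun i => mul_pos (hs i) hα, fun i => mul_pos (hs i) hβ, fun i => ?_⟩
  · have := integral_comp_of_hasLaw hp0.le hp1.le (hY.law i) continuous_id (s i) 0
    simp only [id, zero_add, bernoulliOp] at this
    rw [this]
    exact le_of_eq (by linear_combination s i * hr)
  · filter_upwards [ae_of_hasLaw_standardizedBernoulli (hY.law i)] with ω h
    have h1 := mul_pos (hs i) hα
    have h2 := mul_pos (hs i) hβ
    rcases h with h | h <;> rw [h] <;> constructor <;> linarith
  · rw [mul_div_mul_left _ _ (hs i).ne', div_le_iff₀ hα, div_mul_eq_mul_div, le_div_iff₀ hp0]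
    linarith

theorem mainTheorem3 (p : ℝ) (hp0 : 0 < p) (hp1 : p < 1) :
    (∀ (n : ℕ), 0 < n →
      ∀ (Ω : Type*) [MeasurableSpace Ω] (μ : Measure Ω) [IsProbabilityMeasure μ]
        (Ω' : Type*) [MeasurableSpace Ω'] (ν : Measure Ω') [IsProbabilityMeasure ν]
        (X : Fin n → Ω → ℝ) (a b : Fin n → ℝ) (BS : Fin n → Ω' → ℝ),
        IsBoundedAsymmetric p a b X μ → IsBernoulliSample p BS ν →
        ∀ m : ℝ, mStar p ≤ m → ∀ f ∈ classF3,
          Integrable (fun ω => f (∑ i, X i ω)) μ ∧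
          Integrable (fun ω => f (sMean m a b * ∑ i, BS i ω)) ν ∧
          ∫ ω, f (∑ i, X i ω) ∂μ ≤ ∫ ω, f (sMean m a b * ∑ i, BS i ω) ∂ν) ∧
    (∀ m : ℝ, 0 < m → m < mStar p →
      ∃ (n : ℕ) (_ : 0 < n)
        (Ω : Type) (_ : MeasurableSpace Ω) (μ : Measure Ω) (_ : IsProbabilityMeasure μ)
        (Ω' : Type) (_ : MeasurableSpace Ω') (ν : Measure Ω') (_ : IsProbabilityMeasure ν)
        (X : Fin n → Ω → ℝ) (a b : Fin n → ℝ) (BS : Fin n → Ω' → ℝ),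
        IsBoundedAsymmetric p a b X μ ∧ IsBernoulliSample p BS ν ∧
        ∃ f ∈ classF3,
          ∫ ω, f (sMean m a b * ∑ i, BS i ω) ∂ν < ∫ ω, f (∑ i, X i ω) ∂μ) := by
  constructor
  · intro n hn Ω _ μ _ Ω' _ ν _ X a b BS hX hBS m hm f hf
    obtain ⟨f₁, f₂, hf⟩ := exists_isF3_of_mem_classF3 hf
    refine ⟨integrable_comp_sum (fun i => (hX.measurable i).aemeasurable) hX.ae_abs_le
      hf.continuous, ?_, hX.integral_le hp0 hp1 hn hBS hm hf⟩
    simp only [Finset.mul_sum]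
    exact integrable_comp_sum (fun i => (hBS.law i).aemeasurable.const_mul _)
      (fun i => ae_abs_mul_le_of_hasLaw (hBS.law i) _) hf.continuous
  · intro m hm0 hm
    have := isProbabilityMeasure_standardizedBernoulli hp0.le hp1.le
    obtain ⟨Ω, _, μ, Y, hmeas, hlaw, hind, _⟩ := exists_iid (Fin 2) (standardizedBernoulli p)
    have hY : IsBernoulliSample p Y μ := ⟨hind, hlaw⟩
    obtain ⟨f, f₁, f₂, hf, hlt⟩ := exists_isF3_of_lt_mStar hp0 hp1 hm0 hm
    set c := 1 / (2 * m) with hc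
    obtain ⟨e, he0, he1, he⟩ := exists_bernoulliOp_lt hp0 hp1 (by positivity) hf hlt
    -- The numbers `(a i * b i) ^ m` will be `1 ± e`, with mean `1`, so the two sides are the two
    -- expectations compared in `he`.
    let x : Fin 2 → ℝ := ![1 + e, 1 - e]
    have hx0 : ∀ i, 0 < x i := by
      intro i
      fin_cases i
      · exact (by linarith : 0 < 1 + e)
      · exact (by linarith : 0 < 1 - e)
    have hs : ∀ i, 0 < x i ^ c := fun i => Real.rpow_pos_of_pos (hx0 i) c
    refine ⟨2, two_pos, Ω, _, μ, inferInstance, Ω, _, μ, inferInstance, _, _, _, Y,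
      isBoundedAsymmetric_mul hp0 hp1 hY hmeas hs, hY, f, mem_classF3_of_isF3 hf, ?_⟩
    have hmean : sMean m (fun i => x i ^ c * √(p / (1 - p)))
        (fun i => x i ^ c * √((1 - p) / p)) = 1 ^ c := by
      have h1 : ∀ i, (x i ^ c * √(p / (1 - p)) * (x i ^ c * √((1 - p) / p))) ^ m = x i := by
        intro i
        have h2 : x i ^ c * √(p / (1 - p)) * (x i ^ c * √((1 - p) / p)) = x i ^ (c + c) := by
          rw [Real.rpow_add (hx0 i)]
          linear_combination (x i ^ c * x i ^ c) * sqrt_div_mul_sqrt_div hp0 hp1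
        rw [h2, ← Real.rpow_mul (hx0 i).le, show (c + c) * m = 1 by rw [hc]; field_simp; norm_num,
          Real.rpow_one]
      simp only [sMean, h1]
      rw [Fin.sum_univ_two]
      congr 1
      simp only [x, Matrix.cons_val_zero, Matrix.cons_val_one]
      norm_num
    have h1 := hY.integral_eq hp0.le hp1.le hf.continuous c fun _ => 1
    have h2 := hY.integral_eq hp0.le hp1.le hf.continuous c x
    simp only [← Finset.mul_sum] at h1
    rw [hmean, h1, h2]
    exact he
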